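/- **Theorem 1.1.** Let $K$ be a field, let $1\le m\le n$, and let $A,B\subset K$ be finite sets with $|A|=m$, $|B|=n$. Put $f=\prod_{\alpha\in A}(x-\alpha)=\sum_{i=0}^m f_ix^i$ and $g=\prod_{\beta\in B}(x-\beta)=\sum_{i=0}^n g_ix^i$ in $K[x]$, and $f_i=0$ for $i\notin\{0,\dots,m\}$, $g_i=0$ for $i\notin\{0,\dots,n\}$. For $Y,Z$ finite let $\mathcal R(Y,Z)=\prod_{y\in Y,\,z\in Z}(y-z)$ (equal to $1$ if $Y$ or $Z$ is empty) and $\mathcal R(x,Z)=\prod_{z\in Z}(x-z)$. For $0\le p\le m$, $0\le q\le n$ define Sylvester's double sum $$\operatorname{Syl}_{p,q}(A,B)=\sum_{\substack{A'\subset A,\ |A'|=p\\ B'\subset B,\ |B'|=q}}\mathcal R(A',B')\,\mathcal R(A\setminus A',B\setminus B')\,\frac{\mathcal R(x,A')\,\mathcal R(x,B')}{\mathcal R(A',A\setminus A')\,\mathcal R(B',B\setminus B')}\in K[x].$$ For $0\le e\le m$ (with $e<m$ if $m=n$) and polynomials $u_0,\dots,u_{n-e-1}$, $v_0,\dots,v_{m-e-1}\in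 K[x]$, let $M_e(u;v)$ be the square matrix of size $N=m+n-2e$ whose $j$-th column, $1\le j\le N-1$, has the entries $f_{m+i-j}$ in rows $i=1,\dots,n-e$ and $g_{n+i-j}$ in rows $n-e+i$, $i=1,\dots,m-e$, and whose last column is $(u_{n-e-1},\dots,u_0,v_{m-e-1},\dots,v_0)^T$. Define $$\operatorname{Sres}_e(f,g)=\det M_e(x^if;\,x^ig),\qquad F_e(f,g)=\det M_e(x^i;\,0),\qquad G_e(f,g)=\det M_e(0;\,x^i),$$ where $u_i$ and $v_i$ are given by the indicated expressions, and let $\operatorname{Res}(f,g)=\operatorname{Sres}_0(f,g)$, which is the usual resultant of $f$ and $g$. Set $d=p+q$, $k=m+n-d-1$ and $\sigma=(d-m)(n-q)+d-n-1$. Then: - if $0\le d<m$ or $m=d<n$, then $\operatorname{Syl}_{p,q}(A,B)=(-1)^{p(m-d)}\binom dp\operatorname{Sres}_d(f,g)$; - if $m<d<n-1$, then $\operatorname{Syl}_{p,q}(A,B)=0$; - if $m<d=n-1$, then $\operatorname{Syl}_{p,q}(A,B)=(-1)^{(p+1)(m+n-1)}\binom mp\,f$; - if $n\le d\le m+n-1$,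 then $\operatorname{Sres}_k(f,g)=F_k(f,g)\,f+G_k(f,g)\,g$ and $$\operatorname{Syl}_{p,q}(A,B)=(-1)^{\sigma}\Big(\tbinom{k}{m-p}F_k(f,g)\,f-\tbinom{k}{n-q}G_k(f,g)\,g\Big)=(-1)^{\sigma+1}\Big(\tbinom{k}{n-q}\operatorname{Sres}_k(f,g)-\tbinom{k+1}{m-p}F_k(f,g)\,f\Big);$$ - if $d=m+n$, then $\operatorname{Syl}_{p,q}(A,B)=\operatorname{Res}(f,g)\,f\,g$. -/

import Mathlib

open Polynomial

noncomputable section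

namespace SylvesterSums

/-- `R(Y, Z) = ∏_{y ∈ Y, z ∈ Z} (y - z)`, equal to `1` if `Y` or `Z` is empty. -/
def prodDiff {K : Type*} [Field K] (Y Z : Finset K) : K :=
  ∏ y ∈ Y, ∏ z ∈ Z, (y - z)

/-- `R(x, Z) = ∏_{z ∈ Z} (x - z)`, the monic polynomial in the variable `x` with simple roots `Z`. -/
def rootPoly {K : Type*} [Field K] (Z : Finset K) : K[X] :=
  ∏ z ∈ Z, (X - C z)

/-- Sylvester's double sum `Syl_{p,q}(A, B)`, a polynomial in `x`: the sum over all `A' ⊆ A`,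
`B' ⊆ B` with `|A'| = p`, `|B'| = q`. The denominators are nonzero elements of the field. -/
def syl {K : Type*} [Field K] [DecidableEq K] (p q : ℕ) (A B : Finset K) : K[X] :=
  ∑ A' ∈ A.powersetCard p, ∑ B' ∈ B.powersetCard q,
    C (prodDiff A' B' * prodDiff (A \ A') (B \ B') /
        (prodDiff A' (A \ A') * prodDiff B' (B \ B'))) *
      (rootPoly A' * rootPoly B')

/-- The square matrix of size `m + n - 2d = (n - d) + (m - d)` underlying the subresultants of `f`
(of degree `m`) and `g` (of degree `n`). Every column except the last one holds coefficients:
row `i` of the first block of `n - d` rows is `f_m, f_{m-1}, …` shifted `i` places to the right,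
row `i` of the second block of `m - d` rows is `g_n, g_{n-1}, …` shifted `i` places to the right,
and coefficients with an index out of range are zero. The last column is
`u (n-d-1), …, u 0` in the first block and `v (m-d-1), …, v 0` in the second one. -/
def subresMatrix {K : Type*} [Field K] (m n d : ℕ) (f g : K[X]) (u v : ℕ → K[X]) :
    Matrix (Fin ((n - d) + (m - d))) (Fin ((n - d) + (m - d))) K[X] :=
  Matrix.of fun r c =>
    Fin.addCases
      (fun i : Fin (n - d) =>
        if (c : ℕ) + 1 = (n - d) + (m - d) then u (n - d - 1 - i)
        else if (c : ℕ) ≤ m + i then C (f.coeff (m + i - c)) else 0)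
      (fun i : Fin (m - d) =>
        if (c : ℕ) + 1 = (n - d) + (m - d) then v (m - d - 1 - i)
        else if (c : ℕ) ≤ n + i then C (g.coeff (n + i - c)) else 0) r

/-- The subresultant `Sres_d(f, g)` of `f` of degree `m` and `g` of degree `n`: the last column is
`x^{n-d-1} f, …, f, x^{m-d-1} g, …, g`. -/
def sres {K : Type*} [Field K] (m n d : ℕ) (f g : K[X]) : K[X] :=
  (subresMatrix m n d f g (fun e => X ^ e * f) (fun e => X ^ e * g)).det

/-- The polynomial `F_k(f, g)`: the last column is `x^{n-k-1}, …, 1, 0, …, 0`. -/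
def bezoutF {K : Type*} [Field K] (m n k : ℕ) (f g : K[X]) : K[X] :=
  (subresMatrix m n k f g (fun e => X ^ e) (fun _ => 0)).det

/-- The polynomial `G_k(f, g)`: the last column is `0, …, 0, x^{m-k-1}, …, 1`. -/
def bezoutG {K : Type*} [Field K] (m n k : ℕ) (f g : K[X]) : K[X] :=
  (subresMatrix m n k f g (fun _ => 0) (fun e => X ^ e)).det

end SylvesterSums

end

/-!
Sylvester's double sums are the coefficients of one determinant. Let `f`, `g` be the monic
polynomials with roots `A`, `B`, let `t` be an indeterminate and `e = m + n - d`, and consider the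
linear map `(Q, P) ↦ (Q + (x - X) P on A, Q + t (x - X) P on B)` for `deg Q < e`, `deg P < d`.
Laplace expansion of its determinant `sylDet` along the set of rows that use the columns of `P`
gives products of two Vandermonde determinants. Divided by the Vandermonde determinants of `A` and
of `B`, they are, up to sign, the summands of the double sums, so that `Syl_{p,q}` is `±
sylDet.coeff q` (`coeff_sylDet`). The minors are evaluated without any permutation of rows
(`det_minor_mul`): multiplying a minor by the values of the complementary nodal polynomials turns
it into a Vandermonde matrix times a Sylvester matrix, whose determinant is a resultant. This
needs distinct points, in particular `A ∩ B = ∅`. The result is a polynomial identity, so it is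
proved for indeterminates and specialised.

On the other hand `sylDet` can be computed by column operations, which split off the Vandermonde
determinant of `A` and a power of `t - 1`:
* for `d < m` or `m = d < n`, replacing `P` by `(0 on A, (t - 1) (x - X) P on B)`
  (`sylDet_eq_of_le`);
* for `m < d < n`, the columns are linearly dependent if `d + 1 < n`, and triangular, with the
  value of `f` at `x` on the diagonal, if `d + 1 = n` (`sylDet_eq_zero`, `sylDet_eq_of_succ_eq`);
* for `n ≤ d`, passing to the combinations `W ↦ (W on A, t W + (1 - t) W(x) on B)`
  (`sylDet_eq_of_ge`).

What is left in the first and in the last case is the determinant of the values on `B` of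
multiples of `f` and of `x - X`. After adjoining multiples of `g` it becomes a determinant of
coefficients, and the multiples of `x - X` are eliminated at the price of replacing the
coefficients of `1, X, …, X ^ k` by the value at `x`. This is the subresultant determinant with
its last column (`evalDet_hornerFam`). Comparing the coefficients of `t ^ q`, which are binomial
coefficients up to sign, proves all cases.
-/

namespace SylvesterSums

open Finset

/-! ### Determinants of corners of infinite matrices -/

section NatDet

variable {R : Type*} [CommRing R]

/-- The determinant of the top left `N × N` corner of an infinite matrix with rows and columns
indexed by `ℕ`. Index arithmetic then takes place in `ℕ`, without casts between `Fin` types. -/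
def natDet (N : ℕ) (M : ℕ → ℕ → R) : R :=
  (Matrix.of fun i j : Fin N => M i j).det

lemma natDet_congr {N : ℕ} {M M' : ℕ → ℕ → R}
    (h : ∀ i < N, ∀ j < N, M i j = M' i j) : natDet N M = natDet N M' := by
  unfold natDet
  congr 1
  ext i j
  exact h i i.2 j j.2

lemma natDet_transpose (N : ℕ) (M : ℕ → ℕ → R) :
    natDet N (fun i j => M j i) = natDet N M := by
  unfold natDet
  rw [← Matrix.det_transpose]
  rfl

lemma natDet_mul (N : ℕ) (M U : ℕ → ℕ → R) :
    natDet N (fun i j => ∑ l ∈ range N, M i l * U l j) = natDet N M * natDet N U := by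
  unfold natDet
  rw [← Matrix.det_mul]
  congr 1
  ext i j
  simp only [Matrix.of_apply, Matrix.mul_apply]
  exact (Fin.sum_univ_eq_sum_range (fun l => M i l * U l j) N).symm

lemma natDet_of_upper {N : ℕ} {U : ℕ → ℕ → R} (h : ∀ i < N, ∀ j < i, U i j = 0) :
    natDet N U = ∏ i ∈ range N, U i i := by
  unfold natDet
  rw [Matrix.det_of_isUpperTriangular]
  · exact Fin.prod_univ_eq_prod_range (fun i => U i i) N
  · intro i j hij
    exact h i i.2 j hij

lemma natDet_smul_row (N : ℕ) (r : ℕ → R) (M : ℕ → ℕ → R) :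
    natDet N (fun i j => r i * M i j) = (∏ i ∈ range N, r i) * natDet N M := by
  unfold natDet
  rw [← Fin.prod_univ_eq_prod_range, ← Matrix.det_mul_column]
  rfl

lemma natDet_smul_col (N : ℕ) (r : ℕ → R) (M : ℕ → ℕ → R) :
    natDet N (fun i j => r j * M i j) = (∏ i ∈ range N, r i) * natDet N M := by
  rw [← natDet_transpose N M, ← natDet_smul_row, ← natDet_transpose]

lemma natDet_eq_det_sum (m n : ℕ) (M : ℕ → ℕ → R) :
    natDet (m + n) M =
      (Matrix.of fun i j : Fin m ⊕ Fin n => M (finSumFinEquiv i) (finSumFinEquiv j)).det := by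
  unfold natDet
  rw [← Matrix.det_submatrix_equiv_self (finSumFinEquiv (m := m) (n := n))]
  rfl

/-- A block lower triangular determinant. -/
lemma natDet_block (m n : ℕ) (M : ℕ → ℕ → R)
    (h : ∀ i < m, ∀ j < n, M i (m + j) = 0) :
    natDet (m + n) M = natDet m M * natDet n (fun i j => M (m + i) (m + j)) := by
  rw [natDet_eq_det_sum]
  unfold natDet
  rw [← Matrix.det_fromBlocks_zero₁₂ _ (Matrix.of fun (i : Fin n) (j : Fin m) => M (m + i) j)]
  congr 1
  ext i j
  rcases i with i | i <;> rcases j with j | j <;> simp [h]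

lemma natDet_map {S : Type*} [CommRing S] (φ : R →+* S) (N : ℕ) (M : ℕ → ℕ → R) :
    φ (natDet N M) = natDet N (fun i j => φ (M i j)) := by
  unfold natDet
  rw [RingHom.map_det]
  rfl

lemma natDet_rotate (u v : ℕ) (M : ℕ → ℕ → R) :
    natDet (u + (v + 1)) (fun i j => M (if i < u then i else if i < u + v then i + 1 else u) j) =
      (-1) ^ v * natDet (u + (v + 1)) M := by
  rw [natDet_eq_det_sum, natDet_eq_det_sum]
  set A : Matrix (Fin u ⊕ Fin (v + 1)) (Fin u ⊕ Fin (v + 1)) R :=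
    Matrix.of fun i j => M (finSumFinEquiv i) (finSumFinEquiv j) with hA
  have := Matrix.det_permute (Equiv.Perm.sumCongr (1 : Equiv.Perm (Fin u)) (finRotate (v + 1))) A
  rw [Equiv.Perm.sign_sumCongr, sign_finRotate] at this
  simp only [map_one, one_mul, add_tsub_cancel_right] at this
  push_cast at this
  rw [← this]
  congr 1
  ext i j
  simp only [hA, Matrix.submatrix_apply, Matrix.of_apply, id]
  congr 1
  rcases i with i | i
  · simp
  · rcases Nat.lt_or_ge i v with hi | hi
    · have h2 : finRotate (v + 1) i = ⟨i + 1, by omega⟩ := finRotate_of_lt hi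
      simp [h2, hi]
      omega
    · have h3 : i = Fin.last v := Fin.ext (by simp; omega)
      subst h3
      simp

/-- Exchanging two adjacent blocks of `a` and `b` rows contributes the sign `(-1) ^ (a * b)`. -/
lemma natDet_swap_rows (u a b : ℕ) (M : ℕ → ℕ → R) :
    natDet (u + (a + b)) (fun i j =>
        M (if i < u then i else if i < u + b then i + a else i - b) j) =
      (-1) ^ (a * b) * natDet (u + (a + b)) M := by
  induction a generalizing b with
  | zero =>
    rw [zero_mul, pow_zero, one_mul]
    apply natDet_congr
    intro i hi j _
    congr 1
    split_ifs <;> omega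
  | succ a ih =>
    have h1 := ih (b + 1)
    have h2 := natDet_rotate u (a + b) (fun i j =>
      M (if i < u then i else if i < u + (b + 1) then i + a else i - (b + 1)) j)
    rw [show u + (a + 1 + b) = u + (a + b + 1) by ring]
    rw [show u + (a + (b + 1)) = u + (a + b + 1) by ring] at h1
    rw [h1] at h2
    rw [← mul_assoc, ← pow_add] at h2
    have h3 : ((-1 : R)) ^ (a + b + a * (b + 1)) = (-1) ^ ((a + 1) * b) := by
      rw [show a + b + a * (b + 1) = (a + 1) * b + 2 * a by ring, pow_add, pow_mul (-1 : R) 2 a]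
      simp
    rw [h3] at h2
    rw [← h2]
    apply natDet_congr
    intro i hi j _
    congr 1
    split_ifs <;> omega

lemma natDet_swap_cols (u a b : ℕ) (M : ℕ → ℕ → R) :
    natDet (u + (a + b)) (fun i j =>
        M i (if j < u then j else if j < u + b then j + a else j - b)) =
      (-1) ^ (a * b) * natDet (u + (a + b)) M := by
  rw [← natDet_transpose _ M, ← natDet_swap_rows u a b, ← natDet_transpose]

/-- Reversing the order of the rows and of the columns at once. -/
lemma natDet_reverse (N : ℕ) (M : ℕ → ℕ → R) :
    natDet N (fun i j => M (N - 1 - i) (N - 1 - j)) = natDet N M := by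
  unfold natDet
  rw [← Matrix.det_submatrix_equiv_self (Fin.revPerm (n := N))]
  congr 1
  ext i j
  simp only [Matrix.submatrix_apply, Matrix.of_apply, Fin.revPerm_apply, Fin.val_rev]
  congr 1 <;> omega

end NatDet

/-! ### Nodal polynomials and Vandermonde determinants -/

section Points

variable {R : Type*} [CommRing R]

/-- The monic polynomial with roots `a 0, …, a (m - 1)`. -/
noncomputable def nodal (m : ℕ) (a : ℕ → R) : R[X] := ∏ i ∈ range m, (X - C (a i))

lemma nodal_monic (m : ℕ) (a : ℕ → R) : (nodal m a).Monic := monic_prod_X_sub_C _ _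

lemma nodal_natDegree [Nontrivial R] (m : ℕ) (a : ℕ → R) : (nodal m a).natDegree = m := by
  unfold nodal
  rw [natDegree_finsetProd_X_sub_C_eq_card, card_range]

lemma nodal_eval (m : ℕ) (a : ℕ → R) (x : R) :
    (nodal m a).eval x = ∏ i ∈ range m, (x - a i) := by
  simp [nodal, eval_prod]

lemma nodal_eval_self {m : ℕ} (a : ℕ → R) {i : ℕ} (hi : i < m) : (nodal m a).eval (a i) = 0 := by
  rw [nodal_eval]
  exact prod_eq_zero (mem_range.2 hi) (sub_self _)

/-- The Vandermonde determinant of `a 0, …, a (N - 1)`. -/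
noncomputable def vdm (N : ℕ) (a : ℕ → R) : R := natDet N fun i j => a i ^ j

lemma vdm_ne_zero [IsDomain R] {N : ℕ} {a : ℕ → R} (h : ∀ i < N, ∀ j < N, a i = a j → i = j) :
    vdm N a ≠ 0 := by
  unfold vdm natDet
  exact Matrix.det_vandermonde_ne_zero_iff.2 fun i j hij => Fin.ext (h i i.2 j j.2 hij)

lemma vdm_map {S : Type*} [CommRing S] (φ : R →+* S) (N : ℕ) (a : ℕ → R) :
    φ (vdm N a) = vdm N fun i => φ (a i) := by
  simp [vdm, natDet_map]

/-- The basis `1, x, …, x ^ (m - 1), f, f x, f x ^ 2, …` adapted to division by the monic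
polynomial `f` of degree `m`. -/
noncomputable def divBasis (f : R[X]) (m j : ℕ) : R[X] := if j < m then X ^ j else f * X ^ (j - m)

lemma divBasis_monic {f : R[X]} (hf : f.Monic) (m j : ℕ) : (divBasis f m j).Monic := by
  unfold divBasis
  split_ifs
  · exact monic_X_pow j
  · exact hf.mul (monic_X_pow _)

lemma divBasis_natDegree [Nontrivial R] {f : R[X]} {m : ℕ} (hf : f.Monic) (hm : f.natDegree = m)
    (j : ℕ) : (divBasis f m j).natDegree = j := by
  unfold divBasis
  split_ifs
  · simp
  · rw [hf.natDegree_mul (monic_X_pow _), hm, natDegree_X_pow]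
    omega

/-- The coefficient matrix of monic polynomials of degrees `0, 1, 2, …` is unitriangular. -/
lemma natDet_coeff_monic {N : ℕ} {w : ℕ → R[X]} (hw : ∀ j < N, (w j).Monic)
    (hd : ∀ j < N, (w j).natDegree = j) : natDet N (fun l j => (w j).coeff l) = 1 := by
  rw [natDet_of_upper]
  · apply prod_eq_one
    intro i hi
    rw [mem_range] at hi
    simpa [hd i hi] using (hw i hi).coeff_natDegree
  · intro i hi j hj
    apply coeff_eq_zero_of_natDegree_lt
    rw [hd j (hj.trans hi)]
    exact hj

lemma natDet_eval_monic {N : ℕ} {w : ℕ → R[X]} (hw : ∀ j < N, (w j).Monic)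
    (hd : ∀ j < N, (w j).natDegree = j) (z : ℕ → R) :
    natDet N (fun i j => (w j).eval (z i)) = vdm N z := by
  rw [← mul_one (vdm N z), ← natDet_coeff_monic hw hd, vdm, ← natDet_mul]
  apply natDet_congr
  intro i _ j hj
  rw [eval_eq_sum_range' (show (w j).natDegree < N by rw [hd j hj]; exact hj)]
  exact sum_congr rfl fun _ _ => mul_comm _ _

/-- The sequence `a 0, …, a (m - 1), b 0, b 1, …`. -/
noncomputable def concat (m : ℕ) (a b : ℕ → R) (i : ℕ) : R := if i < m then a i else b (i - m)

/-- The order of the factors of the cross product is the one for which no sign appears. -/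
lemma vdm_concat [Nontrivial R] (m n : ℕ) (a b : ℕ → R) :
    vdm (m + n) (concat m a b) =
      vdm m a * vdm n b * ∏ i ∈ range n, ∏ j ∈ range m, (b i - a j) := by
  rw [← natDet_eval_monic (w := divBasis (nodal m a) m)
    (fun j _ => divBasis_monic (nodal_monic m a) m j)
    (fun j _ => divBasis_natDegree (nodal_monic m a) (nodal_natDegree m a) j), natDet_block]
  · rw [mul_assoc, mul_comm (vdm n b), vdm, vdm, ← natDet_smul_row]
    congr 1
    · apply natDet_congr
      intro i hi j hj
      simp [divBasis, concat, hi, hj]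
    · apply natDet_congr
      intro i _ j _
      simp [divBasis, concat, nodal_eval]
  · intro i hi j _
    simp [divBasis, concat, hi, nodal_eval_self]

end Points

/-! ### Laplace expansion of the generating determinant -/

section Laplace

variable {R : Type*} [CommRing R]

/-- The determinant with columns `x ^ j φ` (`j < e`) and `x ^ j ψ` (`j < d`) is the resultant. -/
lemma natDet_sylvester (e d : ℕ) (φ ψ : R[X]) (hφ : φ.natDegree ≤ d) (hψ : ψ.natDegree ≤ e) :
    natDet (e + d) (fun i j => (if j < e then φ * X ^ j else ψ * X ^ (j - e)).coeff i) =
      resultant ψ φ e d := by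
  unfold natDet resultant
  congr 1
  ext i j
  unfold sylvester
  induction j using Fin.addCases with
  | left j =>
    simp only [Matrix.of_apply, Fin.addCases_left, Fin.val_castAdd, j.2, if_true, coeff_mul_X_pow',
      Set.mem_Icc]
    split_ifs with h1 h2 h2
    · rfl
    · exact coeff_eq_zero_of_natDegree_lt (by omega)
    · omega
    · rfl
  | right j =>
    simp only [Matrix.of_apply, Fin.addCases_right, Fin.val_natAdd, add_lt_iff_neg_left, not_lt_zero,
      if_false, coeff_mul_X_pow', Set.mem_Icc, add_tsub_cancel_left]
    split_ifs with h1 h2 h2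
    · rfl
    · exact coeff_eq_zero_of_natDegree_lt (by omega)
    · omega
    · rfl

/-- The resultant of two split monic polynomials, as a product over the differences of roots. -/
lemma resultant_prod_X_sub_C [Nontrivial R] {ι κ : Type*} (s : Finset ι) (t : Finset κ)
    (y : ι → R) (z : κ → R) :
    resultant (∏ i ∈ s, (X - C (y i))) (∏ j ∈ t, (X - C (z j))) s.card t.card =
      ∏ i ∈ s, ∏ j ∈ t, (y i - z j) := by
  have h1 := natDegree_finsetProd_X_sub_C_eq_card s y
  have h2 := natDegree_finsetProd_X_sub_C_eq_card t z
  have h3 := resultant_prod_left s (fun i => X - C (y i)) (∏ j ∈ t, (X - C (z j))) t.card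
    (by simp) h2.le
  rw [h1] at h3
  rw [h3]
  apply prod_congr rfl
  intro i _
  rw [natDegree_X_sub_C, resultant_X_sub_C_left _ _ _ h2.le, eval_prod]
  simp

/-- The minor of a Laplace expansion of a Vandermonde-like matrix: the rows in `S` use the last
`d` columns and the remaining ones the first `e` columns. -/
lemma det_minor_mul [IsDomain R] {m n d e : ℕ} (h : m + n = e + d) (z : Fin m ⊕ Fin n → R)
    (hz : Function.Injective z) (S : Finset (Fin m ⊕ Fin n)) (hS : S.card = d) :
    (Matrix.of fun i j : Fin m ⊕ Fin n =>
        if i ∈ S then (if (finSumFinEquiv j : ℕ) < e then 0 else z i ^ ((finSumFinEquiv j : ℕ) - e))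
        else (if (finSumFinEquiv j : ℕ) < e then z i ^ (finSumFinEquiv j : ℕ) else 0)).det *
      ∏ i ∈ S, ∏ j ∈ Sᶜ, (z i - z j) =
    (Matrix.of fun i j : Fin m ⊕ Fin n => z i ^ (finSumFinEquiv j : ℕ)).det := by
  set N := (Matrix.of fun i j : Fin m ⊕ Fin n =>
        if i ∈ S then (if (finSumFinEquiv j : ℕ) < e then 0 else z i ^ ((finSumFinEquiv j : ℕ) - e))
        else (if (finSumFinEquiv j : ℕ) < e then z i ^ (finSumFinEquiv j : ℕ) else 0)) with hN
  set φ : R[X] := ∏ i ∈ S, (X - C (z i)) with hφ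
  set ψ : R[X] := ∏ i ∈ Sᶜ, (X - C (z i)) with hψ
  have hSc : Sᶜ.card = e := by
    rw [card_compl, hS]
    simp
    omega
  have dφ : φ.natDegree = d := by rw [hφ, natDegree_finsetProd_X_sub_C_eq_card, hS]
  have dψ : ψ.natDegree = e := by rw [hψ, natDegree_finsetProd_X_sub_C_eq_card, hSc]
  have eφ : ∀ x, φ.eval x = ∏ i ∈ S, (x - z i) := by intro x; simp [hφ, eval_prod]
  have eψ : ∀ x, ψ.eval x = ∏ i ∈ Sᶜ, (x - z i) := by intro x; simp [hψ, eval_prod]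
  have hne : ∏ i ∈ Sᶜ, ∏ j ∈ S, (z i - z j) ≠ 0 := by
    refine prod_ne_zero_iff.2 fun i hi => prod_ne_zero_iff.2 fun j hj => sub_ne_zero.2 fun hij => ?_
    rw [hz hij] at hi
    exact mem_compl.1 hi hj
  have hres : (Matrix.of fun l j : Fin m ⊕ Fin n =>
      (if (finSumFinEquiv j : ℕ) < e then φ * X ^ (finSumFinEquiv j : ℕ)
        else ψ * X ^ ((finSumFinEquiv j : ℕ) - e)).coeff (finSumFinEquiv l : ℕ)).det =
      ∏ i ∈ Sᶜ, ∏ j ∈ S, (z i - z j) := by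
    rw [← resultant_prod_X_sub_C Sᶜ S z z, hS, hSc, ← natDet_sylvester e d φ ψ dφ.le dψ.le, ← h,
      natDet_eq_det_sum]
  -- Row by row: `φ` vanishes on the rows in `S` and `ψ` on the others, so either half of the columns
  -- of the Sylvester matrix contributes to one kind of rows only.
  have key : (∏ i, if i ∈ S then ψ.eval (z i) else φ.eval (z i)) * N.det =
      (Matrix.of fun i j : Fin m ⊕ Fin n => z i ^ (finSumFinEquiv j : ℕ)).det *
        ∏ i ∈ Sᶜ, ∏ j ∈ S, (z i - z j) := by
    rw [← Matrix.det_mul_column, ← hres, ← Matrix.det_mul]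
    congr 1
    ext i j
    have hj : (finSumFinEquiv j : ℕ) < m + n := (finSumFinEquiv j).2
    have hs : ∀ p : R[X], p.natDegree < m + n → p.eval (z i) =
        ∑ l : Fin m ⊕ Fin n, z i ^ (finSumFinEquiv l : ℕ) * p.coeff (finSumFinEquiv l : ℕ) := by
      intro p hp
      rw [eval_eq_sum_range' hp, ← Fin.sum_univ_eq_sum_range (fun l => p.coeff l * z i ^ l),
        ← (finSumFinEquiv (m := m) (n := n)).sum_comp]
      exact sum_congr rfl fun _ _ => mul_comm _ _
    simp only [Matrix.of_apply, Matrix.mul_apply, hN]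
    rw [← hs]
    · by_cases hi : i ∈ S
      · have h0 : φ.eval (z i) = 0 := by rw [eφ]; exact prod_eq_zero hi (sub_self _)
        by_cases hje : (finSumFinEquiv j : ℕ) < e <;> simp [hi, hje, h0]
      · have h0 : ψ.eval (z i) = 0 := by
          rw [eψ]; exact prod_eq_zero (mem_compl.2 hi) (sub_self _)
        by_cases hje : (finSumFinEquiv j : ℕ) < e <;> simp [hi, hje, h0]
    · split_ifs with hje
      · refine lt_of_le_of_lt (natDegree_mul_le) ?_
        rw [natDegree_X_pow, dφ]; omega
      · refine lt_of_le_of_lt (natDegree_mul_le) ?_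
        rw [natDegree_X_pow, dψ]; omega
  have hsplit : (∏ i, if i ∈ S then ψ.eval (z i) else φ.eval (z i)) =
      (∏ i ∈ S, ∏ j ∈ Sᶜ, (z i - z j)) * ∏ i ∈ Sᶜ, ∏ j ∈ S, (z i - z j) := by
    rw [← prod_mul_prod_compl S]
    congr 1
    · exact prod_congr rfl fun i hi => by rw [if_pos hi, eψ]
    · exact prod_congr rfl fun i hi => by rw [if_neg (mem_compl.1 hi), eφ]
  rw [hsplit] at key
  apply mul_right_cancel₀ hne
  rw [← key]
  ring

/-- The points `a 0, …, a (m - 1)` and `b 0, …, b (n - 1)` as one family. -/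
def sumPoints (m n : ℕ) (a b : ℕ → R) : Fin m ⊕ Fin n → R :=
  Sum.elim (fun i => a i) (fun i => b i)

/-- The minor belonging to the set `S` of rows in the Laplace expansion of `sylDet`: the rows in `S`
use the columns from `e` on, the remaining ones the first `e` columns. -/
noncomputable def laplaceMinor (m n e : ℕ) (a b : ℕ → R) (S : Finset (Fin m ⊕ Fin n)) : R :=
  (Matrix.of fun i j : Fin m ⊕ Fin n =>
        if i ∈ S then (if (finSumFinEquiv j : ℕ) < e then 0
          else sumPoints m n a b i ^ ((finSumFinEquiv j : ℕ) - e))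
        else (if (finSumFinEquiv j : ℕ) < e then sumPoints m n a b i ^ (finSumFinEquiv j : ℕ)
          else 0)).det

lemma sumPoints_eq_concat {α : Type*} (m n : ℕ) (a b : ℕ → α) (i : Fin m ⊕ Fin n) :
    sumPoints m n a b i = concat m a b (finSumFinEquiv i : ℕ) := by
  rcases i with i | i <;> simp [sumPoints, concat]

lemma sumPoints_map {S : Type*} [CommRing S] (φ : R →+* S) (m n : ℕ) (a b : ℕ → R)
    (i : Fin m ⊕ Fin n) :
    φ (sumPoints m n a b i) = sumPoints m n (fun i => φ (a i)) (fun i => φ (b i)) i := by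
  rcases i with i | i <;> simp [sumPoints]

lemma laplaceMinor_map {S : Type*} [CommRing S] (φ : R →+* S) (m n e : ℕ) (a b : ℕ → R)
    (s : Finset (Fin m ⊕ Fin n)) :
    φ (laplaceMinor m n e a b s) =
      laplaceMinor m n e (fun i => φ (a i)) (fun i => φ (b i)) s := by
  unfold laplaceMinor
  rw [RingHom.map_det]
  congr 1
  ext i j
  simp only [RingHom.mapMatrix_apply, Matrix.map_apply, Matrix.of_apply, ← sumPoints_map φ]
  split_ifs <;> simp

lemma card_filter_finSumFinEquiv {m n d e : ℕ} (h : m + n = e + d) :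
    #{i : Fin m ⊕ Fin n | ¬ (finSumFinEquiv i : ℕ) < e} = d := by
  have h1 : #{i : Fin m ⊕ Fin n | ¬ (finSumFinEquiv i : ℕ) < e} =
      #{i ∈ range (m + n) | ¬ i < e} := by
    apply card_bij (fun i _ => (finSumFinEquiv i : ℕ))
    · intro i hi
      simpa using hi
    · intro i _ j _ hij
      exact finSumFinEquiv.injective (Fin.ext hij)
    · intro i hi
      rw [mem_filter, mem_range] at hi
      exact ⟨finSumFinEquiv.symm ⟨i, hi.1⟩, by simpa using hi.2, by simp⟩
  have h2 : {i ∈ range (m + n) | ¬ i < e} = Ico e (e + d) := by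
    ext i
    simp only [mem_filter, mem_range, mem_Ico]
    omega
  rw [h1, h2, Nat.card_Ico]
  omega

/-- A permutation contributing to the minor would match `S` with the last `d` columns. -/
lemma laplaceMinor_eq_zero {m n d e : ℕ} (h : m + n = e + d) (a b : ℕ → R)
    {S : Finset (Fin m ⊕ Fin n)} (hS : S.card ≠ d) : laplaceMinor m n e a b S = 0 := by
  unfold laplaceMinor
  rw [Matrix.det_apply]
  apply sum_eq_zero
  intro σ _
  suffices hex : ∃ i, ¬ (σ i ∈ S ↔ ¬ (finSumFinEquiv i : ℕ) < e) by
    obtain ⟨i, hi⟩ := hex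
    rw [prod_eq_zero (mem_univ i), smul_zero]
    simp only [Matrix.of_apply]
    split_ifs <;> tauto
  by_contra hcon
  have hall : ∀ i, σ i ∈ S ↔ ¬ (finSumFinEquiv i : ℕ) < e :=
    fun i => not_not.1 fun hi => hcon ⟨i, hi⟩
  apply hS
  rw [← card_filter_finSumFinEquiv h, ← card_map σ.symm.toEmbedding]
  congr 1
  ext j
  simp only [mem_map_equiv, Equiv.symm_symm, mem_filter, mem_univ, true_and, hall]

lemma compl_disjSum {ι κ : Type*} [Fintype ι] [Fintype κ] [DecidableEq ι] [DecidableEq κ]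
    (s : Finset ι) (t : Finset κ) : (s.disjSum t)ᶜ = sᶜ.disjSum tᶜ := by
  ext i
  rcases i with i | i <;> simp

lemma prod_prod_sub_swap {ι κ : Type*} (s : Finset ι) (t : Finset κ) (y : ι → R) (z : κ → R) :
    ∏ j ∈ t, ∏ i ∈ s, (z j - y i) = (-1) ^ (s.card * t.card) * ∏ i ∈ s, ∏ j ∈ t, (y i - z j) := by
  rw [prod_comm, pow_mul', ← prod_const, ← prod_mul_distrib]
  apply prod_congr rfl
  intro i _
  rw [← prod_const, ← prod_mul_distrib]
  exact prod_congr rfl fun j _ => by ring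

lemma laplaceMinor_mul_of_injective [IsDomain R] {m n d e : ℕ} (h : m + n = e + d) (a b : ℕ → R)
    (hz : Function.Injective (sumPoints m n a b)) (s : Finset (Fin m)) (t : Finset (Fin n))
    (hst : s.card + t.card = d) :
    laplaceMinor m n e a b (s.disjSum t) * ((∏ i ∈ s, ∏ j ∈ sᶜ, (a i - a j)) *
        ∏ i ∈ t, ∏ j ∈ tᶜ, (b i - b j)) =
      (-1) ^ (m * (n - t.card) + s.card * t.card) * (vdm m a * vdm n b) *
        ((∏ i ∈ s, ∏ j ∈ t, (a i - b j)) * ∏ i ∈ sᶜ, ∏ j ∈ tᶜ, (a i - b j)) := by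
  have hM := det_minor_mul h (sumPoints m n a b) hz (s.disjSum t) (by rw [card_disjSum, hst])
  have hV : (Matrix.of fun i j : Fin m ⊕ Fin n =>
      sumPoints m n a b i ^ (finSumFinEquiv j : ℕ)).det = vdm (m + n) (concat m a b) := by
    rw [vdm, natDet_eq_det_sum]
    simp only [sumPoints_eq_concat]
  rw [hV, vdm_concat] at hM
  change laplaceMinor m n e a b (s.disjSum t) * _ = _ at hM
  have hne : ∀ (s : Finset (Fin m)) (t : Finset (Fin n)), ∏ i ∈ s, ∏ j ∈ t, (a i - b j) ≠ 0 := by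
    intro s t
    refine prod_ne_zero_iff.2 fun i _ => prod_ne_zero_iff.2 fun j _ => sub_ne_zero.2 fun hij => ?_
    have := @hz (Sum.inl i) (Sum.inr j) hij
    simp at this
  have hcross : ∏ i ∈ range n, ∏ j ∈ range m, (b i - a j) =
      (-1) ^ (m * n) * (((∏ i ∈ s, ∏ j ∈ t, (a i - b j)) * (∏ i ∈ s, ∏ j ∈ tᶜ, (a i - b j))) *
       ((∏ i ∈ sᶜ, ∏ j ∈ t, (a i - b j)) * ∏ i ∈ sᶜ, ∏ j ∈ tᶜ, (a i - b j))) := by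
    rw [prod_prod_sub_swap, card_range, card_range,
      ← Fin.prod_univ_eq_prod_range (fun i => ∏ j ∈ range n, (a i - b j)),
      ← prod_mul_prod_compl s, ← prod_mul_distrib, ← prod_mul_distrib]
    simp only [← Fin.prod_univ_eq_prod_range (fun j => a _ - b j), prod_mul_prod_compl]
  rw [hcross, compl_disjSum, prod_disjSum] at hM
  simp only [prod_disjSum, prod_mul_distrib] at hM
  have hz1 : ∀ i, sumPoints m n a b (Sum.inl i) = a i := fun _ => rfl
  have hz2 : ∀ i, sumPoints m n a b (Sum.inr i) = b i := fun _ => rfl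
  simp only [hz1, hz2] at hM
  rw [prod_prod_sub_swap sᶜ t (fun i => a i) (fun i => b i)] at hM
  have hs : s.card ≤ m := by simpa using card_le_univ s
  have ht : t.card ≤ n := by simpa using card_le_univ t
  have hsc : sᶜ.card = m - s.card := by rw [card_compl, Fintype.card_fin]
  rw [hsc] at hM
  apply mul_right_cancel₀ (mul_ne_zero (hne s tᶜ) (hne sᶜ t))
  have hsign : ((-1 : R)) ^ (m * n) = (-1) ^ (m * (n - t.card) + s.card * t.card) *
      (-1) ^ ((m - s.card) * t.card) := by
    rw [← pow_add]
    congr 1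
    obtain ⟨u, hu⟩ := Nat.exists_eq_add_of_le hs
    obtain ⟨v, hv⟩ := Nat.exists_eq_add_of_le ht
    rw [show n - t.card = v by omega, show m - s.card = u by omega]
    generalize s.card = σ at *
    generalize t.card = τ at *
    subst hu hv
    ring
  have hu : ((-1 : R)) ^ ((m - s.card) * t.card) ≠ 0 := pow_ne_zero _ (by simp)
  rw [hsign] at hM
  apply mul_left_cancel₀ hu
  linear_combination hM

/-- The minor as a product of differences. This is a polynomial identity in the points, so it
suffices to have it for indeterminates, where the factors `a i - b j` can be cancelled. -/
lemma laplaceMinor_mul {m n d e : ℕ} (h : m + n = e + d) (a b : ℕ → R)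
    (s : Finset (Fin m)) (t : Finset (Fin n)) (hst : s.card + t.card = d) :
    laplaceMinor m n e a b (s.disjSum t) * ((∏ i ∈ s, ∏ j ∈ sᶜ, (a i - a j)) *
        ∏ i ∈ t, ∏ j ∈ tᶜ, (b i - b j)) =
      (-1) ^ (m * (n - t.card) + s.card * t.card) * (vdm m a * vdm n b) *
        ((∏ i ∈ s, ∏ j ∈ t, (a i - b j)) * ∏ i ∈ sᶜ, ∏ j ∈ tᶜ, (a i - b j)) := by
  let a' : ℕ → MvPolynomial (ℕ ⊕ ℕ) ℤ := fun i => MvPolynomial.X (Sum.inl i)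
  let b' : ℕ → MvPolynomial (ℕ ⊕ ℕ) ℤ := fun i => MvPolynomial.X (Sum.inr i)
  have hz : Function.Injective (sumPoints m n a' b') := by
    intro i j hij
    rcases i with i | i <;> rcases j with j | j <;>
      simp [sumPoints, a', b', Fin.ext_iff] at hij ⊢ <;> exact hij
  let φ := MvPolynomial.eval₂Hom (Int.castRingHom R) (Sum.elim a b)
  have ha : ∀ i, φ (a' i) = a i := fun i => by simp [φ, a']
  have hb : ∀ i, φ (b' i) = b i := fun i => by simp [φ, b']
  have := congrArg φ (laplaceMinor_mul_of_injective h a' b' hz s t hst)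
  simpa only [map_mul, map_prod, map_sub, map_pow, map_neg, map_one, laplaceMinor_map, vdm_map,
    ha, hb] using this

/-- The determinant generating Sylvester's double sums. It is the determinant, in monomial bases, of
`(Q, P) ↦ (Q + (x - X) P on the points a, Q + t (x - X) P on the points b)` with
`deg Q < e` and `deg P < m + n - e`. -/
noncomputable def sylDet (m n e : ℕ) (a b : ℕ → R) (x t : R) : R :=
  natDet (m + n) fun i j =>
    if j < e then concat m a b i ^ j
    else concat m (fun i => x - a i) (fun i => t * (x - b i)) i * concat m a b i ^ (j - e)

lemma sylDet_eq_sum (m n e : ℕ) (a b : ℕ → R) (x t : R) :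
    sylDet m n e a b x t = ∑ s : Finset (Fin m), ∑ u : Finset (Fin n),
      (∏ i ∈ s, (x - a i)) * (t ^ u.card * ∏ i ∈ u, (x - b i)) *
        laplaceMinor m n e a b (s.disjSum u) := by
  let w : Fin m ⊕ Fin n → R := sumPoints m n (fun i => x - a i) (fun i => t * (x - b i))
  let p : Fin m ⊕ Fin n → Fin m ⊕ Fin n → R := fun i j =>
    if (finSumFinEquiv j : ℕ) < e then 0
      else w i * sumPoints m n a b i ^ ((finSumFinEquiv j : ℕ) - e)
  let r : Fin m ⊕ Fin n → Fin m ⊕ Fin n → R := fun i j =>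
    if (finSumFinEquiv j : ℕ) < e then sumPoints m n a b i ^ (finSumFinEquiv j : ℕ) else 0
  have h1 : sylDet m n e a b x t =
      (Matrix.detRowAlternating (R := R) (n := Fin m ⊕ Fin n)) (p + r) := by
    rw [sylDet, natDet_eq_det_sum]
    change Matrix.det _ = Matrix.det _
    congr 1
    ext i j
    simp only [Matrix.of_apply, ← sumPoints_eq_concat, Pi.add_apply, p, r, w]
    split_ifs <;> simp
  rw [h1, AlternatingMap.map_add_univ, ← Fintype.sum_prod_type',
    ← (Finset.sumEquiv (α := Fin m) (β := Fin n)).symm.toEquiv.sum_comp]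
  apply sum_congr rfl
  rintro ⟨s, u⟩ -
  change Matrix.detRowAlternating ((s.disjSum u).piecewise p r) = _
  have h2 : (∏ i ∈ s, (x - a i)) * (t ^ u.card * ∏ i ∈ u, (x - b i)) =
      ∏ i, if i ∈ s.disjSum u then w i else 1 := by
    rw [prod_ite_mem, univ_inter, prod_disjSum, ← prod_const, ← prod_mul_distrib]
    rfl
  rw [h2, laplaceMinor, ← Matrix.det_mul_column]
  change Matrix.det _ = Matrix.det _
  congr 1
  ext i j
  by_cases hi : i ∈ s.disjSum u <;> simp [hi, p, r]

end Laplace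

section Coefficients

variable {K : Type*} [Field K]

/-- Sylvester's double sums are the coefficients of `sylDet`: the power of `t` in a term of the
Laplace expansion counts the rows of `B'`, and the number `d` of columns in the second block
then fixes the size of `A'`. -/
lemma coeff_sylDet [DecidableEq K] {m n d e p q : ℕ} (h : m + n = e + d) (hd : d = p + q)
    (a b : ℕ → K) (a' : Fin m ↪ K) (b' : Fin n ↪ K) (ha : ∀ i, a' i = a i) (hb : ∀ i, b' i = b i) :
    (sylDet m n e (fun i => (C (C (a i)) : K[X][X])) (fun i => C (C (b i))) (C X) X).coeff q =
      C (vdm m a * vdm n b) * ((-1) ^ (m * (n - q) + p * q) *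
        syl p q (univ.map a') (univ.map b')) := by
  have hterm : ∀ (s : Finset (Fin m)) (u : Finset (Fin n)),
      ((∏ i ∈ s, ((C X : K[X][X]) - C (C (a i)))) *
        ((X : K[X][X]) ^ u.card * ∏ i ∈ u, (C X - C (C (b i)))) *
        laplaceMinor m n e (fun i => (C (C (a i)) : K[X][X])) (fun i => C (C (b i)))
          (s.disjSum u)).coeff q =
      if q = u.card then if p = s.card then
        C (laplaceMinor m n e a b (s.disjSum u)) *
          ((∏ i ∈ s, (X - C (a i))) * (∏ i ∈ u, (X - C (b i)))) else 0 else 0 := by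
    intro s u
    have h1 : laplaceMinor m n e (fun i => (C (C (a i)) : K[X][X])) (fun i => C (C (b i)))
        (s.disjSum u) = C (C (laplaceMinor m n e a b (s.disjSum u))) := by
      rw [laplaceMinor_map, laplaceMinor_map]
    have h2 : (∏ i ∈ s, ((C X : K[X][X]) - C (C (a i)))) *
        ((X : K[X][X]) ^ u.card * ∏ i ∈ u, (C X - C (C (b i)))) *
        C (C (laplaceMinor m n e a b (s.disjSum u))) =
        C (C (laplaceMinor m n e a b (s.disjSum u)) *
          ((∏ i ∈ s, (X - C (a i))) * (∏ i ∈ u, (X - C (b i))))) * X ^ u.card := by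
      simp only [map_mul, map_prod, map_sub]
      ring
    rw [h1, h2, coeff_C_mul, coeff_X_pow]
    by_cases hq : q = u.card
    · by_cases hp : p = s.card
      · simp [hq, hp]
      · rw [laplaceMinor_eq_zero h a b (by rw [card_disjSum]; omega)]
        simp
    · simp [hq]
  rw [sylDet_eq_sum]
  simp only [finsetSum_coeff, hterm]
  have hA : ∀ s : Finset (Fin m), univ.map a' \ s.map a' = sᶜ.map a' := fun s => by
    rw [← Finset.map_sdiff, compl_eq_univ_sdiff]
  have hB : ∀ s : Finset (Fin n), univ.map b' \ s.map b' = sᶜ.map b' := fun s => by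
    rw [← Finset.map_sdiff, compl_eq_univ_sdiff]
  have hne : ∀ {N : ℕ} (c : Fin N ↪ K) (s : Finset (Fin N)), ∏ i ∈ s, ∏ j ∈ sᶜ, (c i - c j) ≠ 0 := by
    intro N c s
    refine prod_ne_zero_iff.2 fun i hi => prod_ne_zero_iff.2 fun j hj => sub_ne_zero.2 fun hij => ?_
    rw [c.injective hij] at hi
    exact mem_compl.1 hj hi
  rw [syl, powersetCard_map, sum_map, powersetCard_eq_filter, powerset_univ, sum_filter, mul_sum,
    mul_sum]
  apply sum_congr rfl
  intro s _
  simp only [RelEmbedding.coe_toEmbedding, mapEmbedding_apply]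
  by_cases hp : p = s.card
  swap
  · simp [hp, Ne.symm hp]
  rw [if_pos hp.symm, powersetCard_map, sum_map, powersetCard_eq_filter, powerset_univ, sum_filter,
    mul_sum, mul_sum]
  apply sum_congr rfl
  intro u _
  simp only [RelEmbedding.coe_toEmbedding, mapEmbedding_apply]
  by_cases hq : q = u.card
  swap
  · simp [hq, Ne.symm hq]
  rw [if_pos hq.symm, if_pos hq, if_pos hp, hA, hB]
  simp only [prodDiff, rootPoly, prod_map, ha, hb]
  have hM := laplaceMinor_mul h a b s u (by omega)
  have hs := hne a' s
  have hu := hne b' u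
  simp only [ha, hb] at hs hu
  have hM' : laplaceMinor m n e a b (s.disjSum u) =
      (vdm m a * vdm n b) * (-1) ^ (m * (n - q) + p * q) *
        ((∏ i ∈ s, ∏ j ∈ u, (a i - b j)) * (∏ i ∈ sᶜ, ∏ j ∈ uᶜ, (a i - b j)) /
          ((∏ i ∈ s, ∏ j ∈ sᶜ, (a i - a j)) * ∏ i ∈ u, ∏ j ∈ uᶜ, (b i - b j))) := by
    rw [mul_div_assoc', eq_div_iff (mul_ne_zero hs hu), hM, hp, hq]
    ring
  rw [hM', C_mul, C_mul (a := vdm m a * vdm n b), C_pow, C_neg, C_1]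
  ring

end Coefficients

/-! ### Elimination of the multiples of `x - X` -/

section Horner

variable {R : Type*} [CommRing R]

/-- The determinant of the values of `w 0, …, w (n - 1)` at `b 0, …, b (n - 1)`. -/
noncomputable def evalDet (n : ℕ) (b : ℕ → R) (w : ℕ → R[X]) : R :=
  natDet n fun i j => (w j).eval (b i)

/-- Passing from values at the roots of the nodal polynomial `g` to coefficients, after adjoining
the multiples `g, g x, …, g x ^ (r - 1)`. -/
lemma evalDet_eq_natDet_coeff [Nontrivial R] (n r : ℕ) (b : ℕ → R) (w : ℕ → R[X])
    (hw : ∀ j < n, (w j).natDegree < n + r) :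
    evalDet n b w = vdm n b *
      natDet (n + r) (fun i j => (if j < n then w j else nodal n b * X ^ (j - n)).coeff i) := by
  -- Left multiplication by the matrix that evaluates at the points `b` and keeps the
  -- coefficients of degree at least `n`; the multiples of `g` vanish in the evaluation rows.
  have hE : natDet (n + r) (fun i l => if i < n then b i ^ l else if l = i then 1 else 0) =
      vdm n b := by
    rw [← natDet_transpose, natDet_block]
    · have h1 : natDet r (fun i j => if n + j < n then b (n + j) ^ (n + i) else
          if n + i = n + j then (1 : R) else 0) = 1 := by
        rw [natDet_of_upper]
        · simp
        · intro i _ j hj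
          have : n + i ≠ n + j := by omega
          simp [hj.ne']
      rw [h1, mul_one, natDet_transpose]
      exact natDet_congr fun i hi j _ => by simp [hi]
    · intro i hi j _
      have : i ≠ n + j := by omega
      simp [this]
  rw [← hE, ← natDet_mul, natDet_block]
  · have h2 : natDet r (fun i j => ∑ l ∈ range (n + r), (if n + i < n then b (n + i) ^ l else
        if l = n + i then 1 else 0) *
        (if n + j < n then w (n + j) else nodal n b * X ^ (n + j - n)).coeff l) = 1 := by
      rw [natDet_of_upper]
      · apply prod_eq_one
        intro i hi
        rw [mem_range] at hi
        simp only [add_lt_iff_neg_left, not_lt_zero, if_false, ite_mul, one_mul, zero_mul,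
          sum_ite_eq', mem_range, add_lt_add_iff_left, hi, if_true, add_tsub_cancel_left]
        rw [coeff_mul_X_pow]
        simpa [nodal_natDegree] using (nodal_monic n b).coeff_natDegree
      · intro i hi j hj
        simp only [add_lt_iff_neg_left, not_lt_zero, if_false, ite_mul, one_mul, zero_mul,
          sum_ite_eq', mem_range, add_lt_add_iff_left, hi, if_true, add_tsub_cancel_left]
        apply coeff_eq_zero_of_natDegree_lt
        rw [(nodal_monic n b).natDegree_mul (monic_X_pow _), nodal_natDegree, natDegree_X_pow]
        omega
    rw [h2, mul_one]
    apply natDet_congr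
    intro i hi j hj
    rw [eval_eq_sum_range' (hw j hj)]
    simp [hi, hj, mul_comm]
  · intro i hi j hj
    have hd : (nodal n b * X ^ j).natDegree < n + r := by
      rw [(nodal_monic n b).natDegree_mul (monic_X_pow _), nodal_natDegree, natDegree_X_pow]
      omega
    have h0 : (nodal n b * X ^ j).eval (b i) = 0 := by simp [nodal_eval_self b hi]
    rw [eval_eq_sum_range' hd] at h0
    simpa [hi, mul_comm] using h0

/-- The polynomials `w 0, …, w (r - 1)`, followed by the multiples `(x - X) p j` of `x - X`. -/
noncomputable def hornerFam (r : ℕ) (w p : ℕ → R[X]) (x : R) (j : ℕ) : R[X] :=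
  if j < r then w j else (C x - X) * p (j - r)

lemma coeff_sub_mul_succ (x : R) {p : R[X]} {j : ℕ} (hp : p.Monic) (hd : p.natDegree = j) :
    ((C x - X) * p).coeff (j + 1) = -1 := by
  rw [sub_mul, coeff_sub, coeff_C_mul, coeff_X_mul, coeff_eq_zero_of_natDegree_lt (by omega),
    ← hd, hp.coeff_natDegree]
  ring

lemma coeff_sub_mul_of_lt (x : R) {p : R[X]} {i j : ℕ} (hd : p.natDegree = j) (hi : j + 1 < i) :
    ((C x - X) * p).coeff i = 0 := by
  obtain ⟨i, rfl⟩ : ∃ i', i = i' + 1 := ⟨i - 1, by omega⟩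
  rw [sub_mul, coeff_sub, coeff_C_mul, coeff_X_mul, coeff_eq_zero_of_natDegree_lt (by omega),
    coeff_eq_zero_of_natDegree_lt (by omega)]
  ring

lemma natDegree_sub_mul_le (x : R) (p : R[X]) :
    ((C x - X) * p).natDegree ≤ p.natDegree + 1 := by
  refine natDegree_mul_le.trans ?_
  have : (C x - X : R[X]).natDegree ≤ 1 := by
    refine (natDegree_sub_le _ _).trans ?_
    simp [natDegree_X_le]
  omega

/-- Modulo multiples of `x - X`, a polynomial has only its value at `x` left. Replacing the
constant coefficient by this value makes the columns of the multiples triangular. -/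
lemma natDet_hornerFam (r k : ℕ) (w p : ℕ → R[X]) (x : R)
    (hw : ∀ j < r + 1, (w j).natDegree < r + 1 + k) (hp : ∀ j < k, (p j).Monic)
    (hd : ∀ j < k, (p j).natDegree = j) :
    natDet (r + 1 + k) (fun i j => (hornerFam (r + 1) w p x j).coeff i) =
      (-1) ^ (k * (r + 1)) *
        natDet (r + 1) (fun i j => if i = 0 then (w j).eval x else (w j).coeff (k + i)) := by
  have hL : natDet (r + 1 + k) (fun i l => if i = 0 then x ^ l else if l = i then 1 else 0) = 1 := by
    rw [natDet_of_upper]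
    · apply prod_eq_one
      intro i _
      by_cases hi : i = 0 <;> simp [hi]
    · intro i _ j hj
      simp [hj.ne, (Nat.zero_le j).trans_lt hj |>.ne']
  have hdeg : ∀ j < r + 1 + k, (hornerFam (r + 1) w p x j).natDegree < r + 1 + k := by
    intro j hj
    unfold hornerFam
    split_ifs with h
    · exact hw j h
    · refine (natDegree_sub_mul_le _ _).trans_lt ?_
      rw [hd _ (by omega)]
      omega
  have h1 : natDet (r + 1 + k) (fun i j => (hornerFam (r + 1) w p x j).coeff i) =
      natDet (r + 1 + k) (fun i j => if i = 0 then (hornerFam (r + 1) w p x j).eval x else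
        (hornerFam (r + 1) w p x j).coeff i) := by
    rw [← one_mul (natDet _ _), ← hL, ← natDet_mul]
    apply natDet_congr
    intro i hi j hj
    by_cases h : i = 0
    · simp only [h, if_true]
      rw [eval_eq_sum_range' (hdeg j hj)]
      exact sum_congr rfl fun _ _ => mul_comm _ _
    · simp [h, hi]
  -- The rows `1, …, k`, where the multiples of `x - X` are triangular with diagonal `-1`, move to
  -- the end. All other rows of these multiples vanish.
  have h2 := natDet_swap_rows 1 k r
    (fun i j => if i = 0 then (hornerFam (r + 1) w p x j).eval x else
        (hornerFam (r + 1) w p x j).coeff i)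
  rw [show 1 + (k + r) = r + 1 + k by ring] at h2
  have h3 : natDet k (fun i j => ((C x - X) * p j).coeff (i + 1)) = (-1) ^ k := by
    rw [natDet_of_upper, ← card_range k, ← prod_const, card_range]
    · exact prod_congr rfl fun i hi =>
        coeff_sub_mul_succ x (hp i (mem_range.1 hi)) (hd i (mem_range.1 hi))
    · intro i hi j hj
      exact coeff_sub_mul_of_lt x (hd j (hj.trans hi)) (by omega)
  rw [natDet_block (r + 1) k] at h2
  · rw [h1]
    have h4 : ∀ y : R, y = (-1) ^ (k * r) * ((-1) ^ (k * r) * y) := by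
      intro y
      rw [← mul_assoc, ← pow_add, Even.neg_one_pow ⟨_, rfl⟩, one_mul]
    rw [h4 (natDet (r + 1 + k) _), ← h2, mul_add k r 1, pow_add, mul_one k, ← h3, mul_assoc,
      mul_comm (natDet k _)]
    congr 2
    · apply natDet_congr
      intro i hi j hj
      by_cases h : i = 0
      · simp [h, hornerFam, hj]
      · have e : (if i < 1 then i else if i < 1 + r then i + k else i - r) = k + i := by
          split_ifs <;> omega
        have h' : k + i ≠ 0 := by omega
        simp only [e, h, h', hornerFam, hj, if_true, if_false]
    · apply natDet_congr
      intro i hi j hj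
      have e : (if r + 1 + i < 1 then r + 1 + i else if r + 1 + i < 1 + r then r + 1 + i + k
          else r + 1 + i - r) = i + 1 := by
        split_ifs <;> omega
      have h' : ¬ r + 1 + j < r + 1 := by omega
      simp only [e, hornerFam, h', Nat.add_eq_zero_iff, one_ne_zero, and_false, if_false,
        add_tsub_cancel_left]
  · intro i hi j hj
    by_cases h : i = 0
    · have h' : ¬ r + 1 + j < r + 1 := by omega
      simp [h, hornerFam, -add_lt_iff_neg_left, h']
    · have e : (if i < 1 then i else if i < 1 + r then i + k else i - r) = k + i := by
        split_ifs <;> omega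
      have h' : ¬ r + 1 + j < r + 1 := by omega
      have h'' : k + i ≠ 0 := by omega
      simp only [e, hornerFam, h', h'', if_false, add_tsub_cancel_left]
      exact coeff_sub_mul_of_lt x (hd j hj) (by omega)

end Horner

/-! ### Subresultant determinants -/

section Subresultant

variable {R : Type*} [CommRing R]

lemma natDet_row_zero_add {N : ℕ} (hN : 0 < N) (p q : ℕ → R) (M : ℕ → ℕ → R) :
    natDet N (fun i j => if i = 0 then p j + q j else M i j) =
      natDet N (fun i j => if i = 0 then p j else M i j) +
        natDet N (fun i j => if i = 0 then q j else M i j) := by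
  have h : ∀ y : ℕ → R, natDet N (fun i j => if i = 0 then y j else M i j) =
      ((Matrix.of fun i j : Fin N => M i j).updateRow ⟨0, hN⟩ fun j => y j).det := by
    intro y
    unfold natDet
    congr 1
    ext i j
    simp [Matrix.updateRow_apply, Fin.ext_iff]
  rw [h, h, h, ← Matrix.det_updateRow_add]
  rfl

lemma natDet_row_zero_smul {N : ℕ} (hN : 0 < N) (c : R) (p : ℕ → R) (M : ℕ → ℕ → R) :
    natDet N (fun i j => if i = 0 then c * p j else M i j) =
      c * natDet N (fun i j => if i = 0 then p j else M i j) := by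
  have h := natDet_smul_row N (fun i => if i = 0 then c else 1)
    (fun i j => if i = 0 then p j else M i j)
  rw [prod_ite_eq' (range N) 0 (fun _ => c), if_pos (mem_range.2 hN)] at h
  rw [← h]
  apply natDet_congr
  intro i _ j _
  split_ifs <;> simp

/-- The subresultant determinant over any commutative ring, with rows and columns reversed and
exchanged: the row `0` holds the values `v`, `u`, and the row `i > 0` the coefficients of
`x ^ (k + i)` in the columns `g x ^ j` (`j < m - k`) and `f x ^ j` (`j < n - k`). -/
noncomputable def subDet (m n k : ℕ) (f g : R[X]) (u v : ℕ → R) : R :=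
  natDet ((m - k) + (n - k)) fun i j =>
    if i = 0 then (if j < m - k then v j else u (j - (m - k)))
    else (if j < m - k then g * X ^ j else f * X ^ (j - (m - k))).coeff (k + i)

lemma subDet_map {S : Type*} [CommRing S] (φ : R →+* S) (m n k : ℕ) (f g : R[X]) (u v : ℕ → R) :
    φ (subDet m n k f g u v) =
      subDet m n k (f.map φ) (g.map φ) (fun i => φ (u i)) (fun i => φ (v i)) := by
  unfold subDet
  rw [natDet_map]
  congr 1
  funext i j
  split_ifs <;> simp [← coeff_map]

lemma subDet_mul_left {m n k : ℕ} (hk : 0 < (m - k) + (n - k)) (f g : R[X]) (c : R) (u : ℕ → R) :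
    subDet m n k f g (fun i => c * u i) (fun _ => 0) = c * subDet m n k f g u (fun _ => 0) := by
  unfold subDet
  rw [← natDet_row_zero_smul hk]
  congr 1
  funext i j
  split_ifs <;> simp

lemma subDet_mul_right {m n k : ℕ} (hk : 0 < (m - k) + (n - k)) (f g : R[X]) (c : R) (v : ℕ → R) :
    subDet m n k f g (fun _ => 0) (fun i => c * v i) = c * subDet m n k f g (fun _ => 0) v := by
  unfold subDet
  rw [← natDet_row_zero_smul hk]
  congr 1
  funext i j
  split_ifs <;> simp

lemma prod_range_ite_lt (r s : ℕ) (c d : R) :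
    ∏ j ∈ range (r + s), (if j < r then c else d) = c ^ r * d ^ s := by
  rw [prod_range_add]
  congr 1
  · rw [prod_congr rfl fun j hj => if_pos (mem_range.1 hj)]
    simp
  · simp

/-- The effect on the subresultant determinant of multiplying the columns of `f`, except for the
row `0`, by `α`. -/
lemma natDet_subDet_scale [IsDomain R] {m n k : ℕ} (hk : k < n) {α : R} (hα : α ≠ 0)
    (f g : R[X]) (u v : ℕ → R) :
    natDet ((m - k) + (n - k)) (fun i j =>
      if i = 0 then (if j < m - k then v j else u (j - (m - k)))
      else (if j < m - k then (g * X ^ j).coeff (k + i)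
        else α * (f * X ^ (j - (m - k))).coeff (k + i))) =
    α ^ (n - k - 1) * subDet m n k f g u (fun _ => 0) +
      α ^ (n - k) * subDet m n k f g (fun _ => 0) v := by
  have hN : 0 < (m - k) + (n - k) := by omega
  have hadd := natDet_row_zero_add hN (fun j => if j < m - k then 0 else u (j - (m - k)))
    (fun j => if j < m - k then v j else 0)
    (fun i j => if j < m - k then (g * X ^ j).coeff (k + i)
        else α * (f * X ^ (j - (m - k))).coeff (k + i))
  have hcol : ∀ u v : ℕ → R, α ^ (n - k) * subDet m n k f g u v =
      natDet ((m - k) + (n - k)) (fun i j =>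
      if i = 0 then (if j < m - k then v j else α * u (j - (m - k)))
      else (if j < m - k then (g * X ^ j).coeff (k + i)
        else α * (f * X ^ (j - (m - k))).coeff (k + i))) := by
    intro u v
    have := natDet_smul_col ((m - k) + (n - k)) (fun j => if j < m - k then 1 else α) (fun i j =>
      if i = 0 then (if j < m - k then v j else u (j - (m - k)))
      else (if j < m - k then g * X ^ j else f * X ^ (j - (m - k))).coeff (k + i))
    rw [prod_range_ite_lt, one_pow, one_mul] at this
    rw [subDet, ← this]
    apply natDet_congr
    intro i _ j _
    split_ifs <;> simp
  have hU : natDet ((m - k) + (n - k)) (fun i j =>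
      if i = 0 then (if j < m - k then 0 else u (j - (m - k)))
      else (if j < m - k then (g * X ^ j).coeff (k + i)
        else α * (f * X ^ (j - (m - k))).coeff (k + i))) =
      α ^ (n - k - 1) * subDet m n k f g u (fun _ => 0) := by
    -- One more factor `α` is needed in the row `0` to scale full columns.
    apply mul_left_cancel₀ hα
    rw [← mul_assoc, ← pow_succ', Nat.sub_add_cancel (by omega), hcol, ← natDet_row_zero_smul hN]
    congr 1
    funext i j
    split_ifs <;> simp
  rw [← hU, hcol]
  simp only [mul_zero]
  rw [← hadd]
  congr 1
  funext i j
  split_ifs <;> simp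

lemma subDet_add [IsDomain R] {m n k : ℕ} (hk : k < n) (f g : R[X]) (u v : ℕ → R) :
    subDet m n k f g u v =
      subDet m n k f g u (fun _ => 0) + subDet m n k f g (fun _ => 0) v := by
  have := natDet_subDet_scale (m := m) hk (one_ne_zero (α := R)) f g u v
  rw [one_pow, one_pow, one_mul, one_mul] at this
  rw [← this, subDet]
  congr 1
  funext i j
  split_ifs <;> simp

/-- Reversing rows and columns at once costs no sign. -/
lemma det_subresMatrix {K : Type*} [Field K] {m n k : ℕ} (hm : k ≤ m) (hn : k ≤ n) (f g : K[X])
    (u v : ℕ → K[X]) :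
    (subresMatrix m n k f g u v).det = subDet m n k (f.map C) (g.map C) u v := by
  unfold subDet
  rw [add_comm (m - k), ← natDet_transpose, ← natDet_reverse]
  unfold natDet
  congr 1
  refine Matrix.ext fun r c => ?_
  have hc := c.2
  rw [subresMatrix]
  simp only [Matrix.of_apply]
  induction r using Fin.addCases with
  | left i =>
    have hi := i.2
    have h1 : ¬ (n - k + (m - k) - 1 - (i : ℕ) < m - k) := by omega
    simp only [Fin.addCases_left, Fin.val_castAdd, h1, if_false, coeff_mul_X_pow', coeff_map]
    by_cases hl : (c : ℕ) + 1 = n - k + (m - k)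
    · rw [if_pos hl, if_pos (by omega)]
      congr 1
      omega
    · have h0 : ¬ n - k + (m - k) - 1 - (c : ℕ) = 0 := by omega
      rw [if_neg hl, if_neg h0]
      split_ifs
      · congr 2; omega
      · omega
      · omega
      · rfl
  | right i =>
    have hi := i.2
    have h1 : (n - k + (m - k) - 1 - (n - k + (i : ℕ)) < m - k) := by omega
    simp only [Fin.addCases_right, Fin.val_natAdd, h1, if_true, coeff_mul_X_pow', coeff_map]
    by_cases hl : (c : ℕ) + 1 = n - k + (m - k)
    · rw [if_pos hl, if_pos (by omega)]
      congr 1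
      omega
    · have h0 : ¬ n - k + (m - k) - 1 - (c : ℕ) = 0 := by omega
      rw [if_neg hl, if_neg h0]
      split_ifs
      · congr 2; omega
      · omega
      · omega
      · rfl

/-- The determinant of values at the roots of `g` that all reductions lead to, in terms of
subresultant determinants. -/
lemma evalDet_hornerFam [IsDomain R] {m n k : ℕ} (hkm : k ≤ m) (hkn : k < n) (b : ℕ → R) (f : R[X])
    (hf : f.natDegree ≤ m) (x α : R) (hα : α ≠ 0) :
    evalDet n b (hornerFam (n - k)
      (fun j => C α * (f * X ^ j) + C ((1 - α) * (f * X ^ j).eval x)) (fun j => X ^ j) x) =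
    (-1) ^ (m * (n - k)) * vdm n b *
      (α ^ (n - k - 1) * (f.eval x * subDet m n k f (nodal n b) (fun j => x ^ j) (fun _ => 0)) +
       α ^ (n - k) * ((nodal n b).eval x *
          subDet m n k f (nodal n b) (fun _ => 0) (fun j => x ^ j))) := by
  obtain ⟨s, rfl⟩ := Nat.exists_eq_add_of_le hkm
  obtain ⟨r, rfl⟩ : ∃ r, n = k + (r + 1) := ⟨n - k - 1, by omega⟩
  set n := k + (r + 1) with hn
  set g := nodal n b with hg
  set U : ℕ → R[X] := fun j => C α * (f * X ^ j) + C ((1 - α) * (f * X ^ j).eval x) with hU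
  have e1 : n - k = r + 1 := by omega
  have e2 : k + s - k = s := by omega
  have hUd : ∀ j < r + 1, (U j).natDegree < n + s := by
    intro j hj
    refine (natDegree_add_C).trans_lt ((natDegree_C_mul_le _ _).trans_lt ?_)
    refine natDegree_mul_le.trans_lt ?_
    rw [natDegree_X_pow]
    omega
  have hgd : ∀ j < s, (g * X ^ j).natDegree < n + s := by
    intro j hj
    rw [(nodal_monic n b).natDegree_mul (monic_X_pow _), nodal_natDegree, natDegree_X_pow]
    omega
  rw [e1, evalDet_eq_natDet_coeff n s b]
  swap
  · intro j hj
    unfold hornerFam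
    split_ifs with h
    · exact hUd j h
    · refine (natDegree_sub_mul_le _ _).trans_lt ?_
      rw [natDegree_X_pow]
      omega
  -- The adjoined multiples of `g` move to the front.
  set W : ℕ → R[X] := fun j => if j < s then g * X ^ j else U (j - s) with hW
  have hsw := natDet_swap_cols 0 n s (fun i j =>
    (if j < n then hornerFam (r + 1) U (fun j => X ^ j) x j else g * X ^ (j - n)).coeff i)
  have hH := natDet_hornerFam (s + r) k W (fun j => X ^ j) x
    (fun j hj => by
      simp only [hW]
      split_ifs with h
      · exact (hgd j h).trans_eq (by omega)
      · exact (hUd (j - s) (by omega)).trans_eq (by omega))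
    (fun j _ => monic_X_pow j) (fun j _ => natDegree_X_pow j)
  have hsame : natDet (s + r + 1 + k)
      (fun i j => (hornerFam (s + r + 1) W (fun j => X ^ j) x j).coeff i) =
      (-1) ^ (n * s) * natDet (n + s) (fun i j =>
    (if j < n then hornerFam (r + 1) U (fun j => X ^ j) x j else g * X ^ (j - n)).coeff i) := by
    rw [zero_add] at hsw
    rw [← hsw, show s + r + 1 + k = n + s by omega]
    apply natDet_congr
    intro i _ j hj
    congr 1
    by_cases h : j < s
    · simp [h, hornerFam, hW, show j < s + r + 1 by omega]
    · simp only [h, hornerFam, hW, zero_add, not_lt_zero, if_false, show j - s < n by omega,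
        if_true]
      by_cases h2 : j < s + r + 1
      · rw [if_pos h2, if_pos (by omega)]
      · rw [if_neg h2, if_neg (by omega), show j - (s + r + 1) = j - s - (r + 1) by omega]
  rw [hsame] at hH
  have hscale := natDet_subDet_scale (m := k + s) hkn hα f g (fun j => f.eval x * x ^ j)
    (fun j => g.eval x * x ^ j)
  rw [subDet_mul_left (by omega), subDet_mul_right (by omega)] at hscale
  rw [e1] at hscale
  rw [← hscale]
  have hfin : natDet (s + r + 1)
      (fun i j => if i = 0 then eval x (W j) else (W j).coeff (k + i)) =
      natDet (k + s - k + (r + 1)) (fun i j => if i = 0 then if j < k + s - k then eval x g * x ^ j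
        else eval x f * x ^ (j - (k + s - k)) else if j < k + s - k then (g * X ^ j).coeff (k + i)
        else α * (f * X ^ (j - (k + s - k))).coeff (k + i)) := by
    rw [e2]
    apply natDet_congr
    intro i _ j _
    simp only [hW, hU]
    by_cases h : j < s
    · simp [h]
    · by_cases hi : i = 0
      · simp only [hi, h, if_true, if_false, eval_add, eval_mul, eval_C, eval_pow, eval_X]
        ring
      · simp only [hi, h, if_false, coeff_add, coeff_C_mul, coeff_C, Nat.add_eq_zero_iff, and_false,
          add_zero]
  rw [hfin] at hH
  have hsq : ((-1 : R)) ^ (n * s) * (-1) ^ (n * s) = 1 := by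
    rw [← pow_add, Even.neg_one_pow ⟨_, rfl⟩]
  have hsign : ((-1 : R)) ^ ((k + s) * (r + 1)) = (-1) ^ (n * s) * (-1) ^ (k * (s + r + 1)) := by
    rw [← pow_add, show n * s + k * (s + r + 1) = (k + s) * (r + 1) + 2 * (k * s) by
      rw [hn]; ring, pow_add, pow_mul (-1 : R) 2]
    simp
  rw [hsign]
  linear_combination (vdm n b * (-1) ^ (n * s)) * hH -
    (vdm n b * natDet (n + s) (fun i j =>
    (if j < n then hornerFam (r + 1) U (fun j => X ^ j) x j else g * X ^ (j - n)).coeff i)) * hsq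

end Subresultant

/-! ### Reduction of the generating determinant -/

section Reduction

variable {R : Type*} [CommRing R]

/-- The weights `x - a i`, followed by `t (x - b j)`. -/
noncomputable def sylWeight (m : ℕ) (a b : ℕ → R) (x t : R) : ℕ → R :=
  concat m (fun i => x - a i) (fun i => t * (x - b i))

/-- Change of basis in `sylDet`: the columns are replaced by monic polynomials, and the columns of
the second block may be modified by combinations of those of the first block. -/
lemma sylDet_eq_of_monic {m n e d : ℕ} (h : m + n = e + d) (a b : ℕ → R) (x t : R)
    (q p s : ℕ → R[X]) (hq : ∀ j < e, (q j).Monic) (hqd : ∀ j < e, (q j).natDegree = j)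
    (hp : ∀ j < d, (p j).Monic) (hpd : ∀ j < d, (p j).natDegree = j)
    (hs : ∀ j < d, (s j).natDegree < e) :
    sylDet m n e a b x t = natDet (m + n) fun i j =>
      if j < e then (q j).eval (concat m a b i)
      else sylWeight m a b x t i * (p (j - e)).eval (concat m a b i) +
        (s (j - e)).eval (concat m a b i) := by
  have hU : natDet (e + d) (fun l j => if j < e then (q j).coeff l
      else if l < e then (s (j - e)).coeff l else (p (j - e)).coeff (l - e)) = 1 := by
    rw [natDet_of_upper, prod_range_add, prod_eq_one, prod_eq_one, one_mul]
    · intro i hi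
      rw [mem_range] at hi
      have := (hp i hi).coeff_natDegree
      rw [hpd i hi] at this
      simpa using this
    · intro i hi
      rw [mem_range] at hi
      have := (hq i hi).coeff_natDegree
      rw [hqd i hi] at this
      simpa [hi] using this
    · intro i hi j hj
      by_cases h1 : j < e
      · rw [if_pos h1]
        exact coeff_eq_zero_of_natDegree_lt (by rw [hqd j h1]; exact hj)
      · rw [if_neg h1, if_neg (by omega)]
        apply coeff_eq_zero_of_natDegree_lt
        rw [hpd _ (by omega)]
        omega
  rw [sylDet, h, ← mul_one (natDet (e + d) _), ← hU, ← natDet_mul]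
  apply natDet_congr
  intro i _ j hj
  rw [sum_range_add]
  change _ + ∑ l ∈ range d, _ = _
  by_cases h1 : j < e
  · have h2 : ∀ l, (q j).coeff (e + l) = 0 := fun l =>
      coeff_eq_zero_of_natDegree_lt (by rw [hqd j h1]; omega)
    rw [if_pos h1, eval_eq_sum_range' (show (q j).natDegree < e by rw [hqd j h1]; exact h1)]
    simp only [h1, h2, if_true, mul_zero, sum_const_zero, add_zero]
    exact sum_congr rfl fun l hl => by rw [if_pos (mem_range.1 hl), mul_comm]
  · rw [if_neg h1, eval_eq_sum_range' (hs (j - e) (by omega)),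
      eval_eq_sum_range' (show (p (j - e)).natDegree < d by rw [hpd _ (by omega)]; omega), mul_sum,
      add_comm]
    simp only [h1, if_false]
    congr 1
    · refine sum_congr rfl fun l _ => ?_
      rw [if_neg (by omega), if_neg (by omega), add_tsub_cancel_left]
      simp only [sylWeight]
      ring
    · refine sum_congr rfl fun l hl => ?_
      rw [if_pos (mem_range.1 hl), if_pos (mem_range.1 hl), mul_comm]

/-- If the rows of the points `a` are supported on the first `m` columns, and these columns contain
a monic basis, then the Vandermonde determinant of `a` splits off. -/
lemma natDet_split_left {m n : ℕ} (a : ℕ → R) (w : ℕ → R[X]) (hw : ∀ j < m, (w j).Monic)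
    (hd : ∀ j < m, (w j).natDegree = j) (M : ℕ → ℕ → R)
    (h1 : ∀ i < m, ∀ j < m, M i j = (w j).eval (a i)) (h2 : ∀ i < m, ∀ j < n, M i (m + j) = 0) :
    natDet (m + n) M = vdm m a * natDet n fun i j => M (m + i) (m + j) := by
  rw [natDet_block m n M h2, ← natDet_eval_monic hw hd]
  congr 1
  exact natDet_congr h1

variable [Nontrivial R]

/-- The columns of `sylDet` are dependent, by `P = f` and `Q = -t (x - X) f`. -/
lemma sylDet_eq_zero {m n e d : ℕ} (h : m + n = e + d) (hmd : m < d) (hdn : d + 1 < n)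
    (a b : ℕ → R) (x t : R) : sylDet m n e a b x t = 0 := by
  rw [sylDet_eq_of_monic h a b x t (fun j => X ^ j) (divBasis (nodal m a) m)
    (fun j => if j = m then - (C t * ((C x - X) * nodal m a)) else 0)
    (fun j _ => monic_X_pow j) (fun j _ => natDegree_X_pow j)
    (fun j _ => divBasis_monic (nodal_monic m a) m j)
    (fun j _ => divBasis_natDegree (nodal_monic m a) (nodal_natDegree m a) j)]
  · unfold natDet
    apply Matrix.det_eq_zero_of_column_eq_zero (⟨e + m, by omega⟩ : Fin (m + n))
    intro i
    have hem : ¬ e + m < e := by omega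
    simp only [Matrix.of_apply, hem, if_false, add_tsub_cancel_left, divBasis, lt_irrefl,
      tsub_self, pow_zero, mul_one, if_true]
    by_cases hi : (i : ℕ) < m
    · simp [sylWeight, concat, hi, nodal_eval_self]
    · simp only [sylWeight, concat, hi, if_false, eval_neg, eval_mul, eval_sub, eval_C, eval_X]
      ring
  · intro j _
    split_ifs
    · rw [natDegree_neg]
      refine (natDegree_C_mul_le _ _).trans_lt ((natDegree_sub_mul_le _ _).trans_lt ?_)
      rw [nodal_natDegree]
      omega
    · simp
      omega

/-- Subtracting `(x - X) P` from `Q` leaves the second block with `(t - 1) (x - X) P` on the points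
`b` and zeros on the points `a`. -/
lemma sylDet_eq_of_le {m n e d : ℕ} (h : m + n = e + d) (hde : d < e) (hdn : d ≤ n)
    (a b : ℕ → R) (x t : R) :
    sylDet m n e a b x t = vdm m a * ((t - 1) ^ d * evalDet n b
      (hornerFam (n - d) (fun j => nodal m a * X ^ j) (fun j => X ^ j) x)) := by
  have hme : m ≤ e := by omega
  rw [sylDet_eq_of_monic h a b x t (divBasis (nodal m a) m) (fun j => X ^ j)
    (fun j => - ((C x - X) * X ^ j))
    (fun j _ => divBasis_monic (nodal_monic m a) m j)
    (fun j _ => divBasis_natDegree (nodal_monic m a) (nodal_natDegree m a) j)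
    (fun j _ => monic_X_pow j) (fun j _ => natDegree_X_pow j)
    (fun j hj => by
      rw [natDegree_neg]
      refine (natDegree_sub_mul_le _ _).trans_lt ?_
      rw [natDegree_X_pow]
      omega),
    natDet_split_left a (fun j => X ^ j) (fun j _ => monic_X_pow j) (fun j _ => natDegree_X_pow j)]
  · congr 1
    have hp := prod_range_ite_lt (n - d) d 1 (t - 1)
    rw [one_pow, one_mul, Nat.sub_add_cancel hdn] at hp
    rw [← hp, evalDet, ← natDet_smul_col]
    apply natDet_congr
    intro i _ j hj
    have hi : ¬ m + i < m := by omega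
    by_cases hj' : j < n - d
    · have h1 : m + j < e := by omega
      have h2 : ¬ m + j < m := by omega
      simp only [h1, h2, hj', if_true, if_false, hornerFam, divBasis, add_tsub_cancel_left,
        concat, hi, one_mul]
    · have h1 : ¬ m + j < e := by omega
      have h3 : m + j - e = j - (n - d) := by omega
      simp only [h1, hj', h3, if_false, hornerFam, add_tsub_cancel_left, concat, sylWeight, hi,
        eval_neg, eval_mul, eval_sub, eval_C, eval_X, eval_pow]
      ring
  · intro i hi j hj
    have h1 : j < e := by omega
    simp [h1, hi, hj, divBasis, concat]
  · intro i hi j hj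
    have h2 : ¬ m + j < m := by omega
    by_cases h1 : m + j < e
    · simp [-add_lt_iff_neg_left, h1, h2, hi, divBasis, concat, nodal_eval_self]
    · simp [-add_lt_iff_neg_left, h1, hi, concat, sylWeight]

/-- Here `deg Q ≤ m`, so that `(x - X) P` can only be subtracted for `deg P < m`. The remaining
columns of the second block are multiples of `f` and vanish on the points `a`. -/
lemma sylDet_eq_of_succ_eq {m n e d : ℕ} (h : m + n = e + d) (hmd : m < d) (hdn : d + 1 = n)
    (a b : ℕ → R) (x t : R) :
    sylDet m n e a b x t = vdm m a * vdm n b *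
      ((t - 1) ^ m * t ^ (d - m) * ((-1) ^ d * (nodal m a).eval x)) := by
  have he : e = m + 1 := by omega
  subst he
  set f := nodal m a with hf
  have hfm : f.Monic := nodal_monic m a
  have hfd : f.natDegree = m := nodal_natDegree m a
  rw [sylDet_eq_of_monic h a b x t (divBasis f m) (divBasis f m)
    (fun j => if j < m then - ((C x - X) * X ^ j) else 0)
    (fun j _ => divBasis_monic hfm m j) (fun j _ => divBasis_natDegree hfm hfd j)
    (fun j _ => divBasis_monic hfm m j) (fun j _ => divBasis_natDegree hfm hfd j)
    (fun j hj => by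
      split_ifs
      · rw [natDegree_neg]
        refine (natDegree_sub_mul_le _ _).trans_lt ?_
        rw [natDegree_X_pow]
        omega
      · simp),
    natDet_split_left a (fun j => X ^ j) (fun j _ => monic_X_pow j) (fun j _ => natDegree_X_pow j)]
  · rw [mul_assoc]
    congr 1
    have hw : evalDet n b (hornerFam 1 (fun _ => f) (divBasis f m) x) =
        vdm n b * ((-1) ^ d * f.eval x) := by
      rw [evalDet_eq_natDet_coeff n 0]
      · congr 1
        have := natDet_hornerFam 0 d (fun _ => f) (divBasis f m) x (fun j _ => by omega)
          (fun j _ => divBasis_monic hfm m j) (fun j _ => divBasis_natDegree hfm hfd j)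
        rw [zero_add, mul_one] at this
        rw [add_zero, show n = 1 + d by omega]
        rw [natDet_congr (M' := fun i j => (hornerFam 1 (fun _ => f) (divBasis f m) x j).coeff i),
          this]
        · simp [natDet]
        · intro i _ j hj
          rw [if_pos (by omega)]
      · intro j hj
        unfold hornerFam
        split_ifs
        · change f.natDegree < n + 0
          omega
        · refine (natDegree_sub_mul_le _ _).trans_lt ?_
          rw [divBasis_natDegree hfm hfd]
          omega
    have hp : ∏ j ∈ range n, (if j < 1 then 1 else if j < 1 + m then t - 1 else t) =
        (t - 1) ^ m * t ^ (d - m) := by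
      rw [show n = 1 + (m + (d - m)) by omega, prod_range_add, prod_range_one, if_pos one_pos,
        one_mul, ← prod_range_ite_lt]
      apply prod_congr rfl
      intro j _
      rw [if_neg (by omega)]
      simp
    rw [mul_left_comm, ← hw, ← hp, evalDet, ← natDet_smul_col]
    apply natDet_congr
    intro i _ j hj
    have hi : ¬ m + i < m := by omega
    by_cases hj' : j < 1
    · obtain rfl : j = 0 := by omega
      simp [hornerFam, divBasis, concat]
    · have h1 : ¬ m + j < m + 1 := by omega
      have h3 : m + j - (m + 1) = j - 1 := by omega
      by_cases h4 : j < 1 + m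
      · have h5 : j - 1 < m := by omega
        simp only [h1, hj', h3, h4, h5, if_false, if_true, hornerFam, add_tsub_cancel_left, concat,
          sylWeight, hi, divBasis, eval_neg, eval_mul, eval_sub, eval_C, eval_X, eval_pow]
        ring
      · have h5 : ¬ j - 1 < m := by omega
        simp only [h1, hj', h3, h4, h5, if_false, hornerFam, add_tsub_cancel_left, concat,
          sylWeight, hi, divBasis, eval_zero, eval_mul, eval_sub, eval_C, eval_X, eval_pow]
        ring
  · intro i hi j hj
    have h1 : j < m + 1 := by omega
    simp [h1, hi, hj, divBasis, concat]
  · intro i hi j hj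
    have h2 : ¬ m + j < m := by omega
    by_cases h1 : m + j < m + 1
    · simp [-add_lt_iff_neg_left, h1, h2, hi, divBasis, concat, hf, nodal_eval_self]
    · by_cases h4 : m + j - (m + 1) < m
      · simp [-add_lt_iff_neg_left, -add_lt_add_iff_left, h1, h4, hi, concat, sylWeight, divBasis]
      · simp [-add_lt_iff_neg_left, -add_lt_add_iff_left, h1, h4, hi, concat, sylWeight, divBasis,
          hf, nodal_eval_self]

/-- Division of a monic polynomial by `X - x`. -/
lemma exists_eq_eval_sub_mul (x : R) {p : R[X]} {j : ℕ} (hp : p.Monic) (hd : p.natDegree = j) :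
    ∃ h : R[X], p = C (p.eval x) - (C x - X) * h ∧ h.natDegree ≤ j - 1 ∧
      (0 < j → h.coeff (j - 1) = 1) := by
  have h1 : p = C (p.eval x) - (C x - X) * (p /ₘ (X - C x)) := by
    have := modByMonic_add_div p (X - C x)
    rw [modByMonic_X_sub_C_eq_C_eval] at this
    linear_combination -this
  have h2 : (p /ₘ (X - C x)).natDegree = j - 1 := by
    rw [natDegree_divByMonic p (monic_X_sub_C x), hd, natDegree_X_sub_C]
  refine ⟨p /ₘ (X - C x), h1, h2.le, fun hj => ?_⟩
  rw [← h2, coeff_natDegree, leadingCoeff_divByMonic_of_monic (monic_X_sub_C x)]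
  · exact hp
  · rw [degree_X_sub_C, degree_eq_natDegree hp.ne_zero, hd]
    exact_mod_cast hj

/-- In the range `n ≤ d`, where `e = k + 1 ≤ m`, the constant column of the first block
together with the columns of the second block spans all polynomials `p` of degree at most `d` in
the form `p` on the points `a` and `t p + (1 - t) p(x)` on the points `b`. -/
lemma sylDet_eq_of_ge {m n k d : ℕ} (h : m + n = k + 1 + d) (hmd : m ≤ d) (hkm : k < m)
    (hkn : k < n) (a b : ℕ → R) (x t : R) :
    sylDet m n (k + 1) a b x t = (-1) ^ (k * d + (d + k)) * vdm m a * ((1 - t) ^ k * evalDet n b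
      (hornerFam (n - k) (fun j => C t * (nodal m a * X ^ j) +
        C ((1 - t) * (nodal m a * X ^ j).eval x)) (fun j => X ^ j) x)) := by
  set f := nodal m a with hf
  have hfm : f.Monic := nodal_monic m a
  have hfd : f.natDegree = m := nodal_natDegree m a
  set z := concat m a b with hz
  set W := sylWeight m a b x t with hW
  set p := divBasis f m with hp
  have hpm : ∀ j, (p j).Monic := divBasis_monic hfm m
  have hpd : ∀ j, (p j).natDegree = j := divBasis_natDegree hfm hfd
  -- `p j = p j (x) - (x - X) y j` expresses the new columns through the old ones.
  choose y hy hyd hyc using fun j => exists_eq_eval_sub_mul x (hpm j) (hpd j)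
  have hswap := natDet_swap_cols 1 k d (fun i j =>
    if j < k + 1 then z i ^ j else W i * z i ^ (j - (k + 1)))
  -- The new column `j` is `S j + W * Y j`, where `S j` uses the first block and `Y j` the second.
  let S : ℕ → R[X] := fun j => if j ≤ d then C ((p j).eval x) else (C x - X) * X ^ (j - (d + 1))
  let Y : ℕ → R[X] := fun j => if j ≤ d then (if j = 0 then 0 else - y j) else - X ^ (j - (d + 1))
  have hS : ∀ j < 1 + (d + k), (S j).natDegree < k + 1 := by
    intro j hj
    simp only [S]
    split_ifs
    · simp
    · refine (natDegree_sub_mul_le _ _).trans_lt ?_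
      rw [natDegree_X_pow]
      omega
  have hY : ∀ j < 1 + (d + k), (Y j).natDegree < d := by
    intro j hj
    simp only [Y]
    split_ifs
    · simp; omega
    · rw [natDegree_neg]
      have := hyd j
      omega
    · rw [natDegree_neg, natDegree_X_pow]
      omega
  -- This family is an upper triangular combination of the old columns, in the order
  -- constant column, second block, rest of the first block; the diagonal is `1, -1, …, -1`.
  have hU : natDet (1 + (d + k)) (fun l j => if l = 0 then (S j).coeff 0 else
      if l ≤ d then (Y j).coeff (l - 1) else (S j).coeff (l - d)) = (-1) ^ (d + k) := by
    rw [natDet_of_upper, prod_range_add, prod_range_one]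
    · have hp0 : p 0 = 1 := eq_one_of_monic_natDegree_zero (hpm 0) (hpd 0)
      have h0 : (S 0).coeff 0 = 1 := by simp [S, hp0]
      rw [if_pos rfl, h0, one_mul, ← card_range (d + k), ← prod_const, card_range]
      apply prod_congr rfl
      intro j _
      rw [if_neg (by omega)]
      by_cases hj : 1 + j ≤ d
      · have := hyc (1 + j) (by omega)
        rw [if_pos hj]
        simp only [Y, hj, if_true]
        rw [if_neg (by omega), coeff_neg, this]
      · rw [if_neg hj]
        simp only [S, hj, if_false]
        rw [show 1 + j - d = 1 + j - (d + 1) + 1 by omega]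
        exact coeff_sub_mul_succ x (monic_X_pow _) (natDegree_X_pow _)
    · intro l hl j hj
      rw [if_neg (by omega)]
      by_cases h1 : j ≤ d
      · by_cases h2 : l ≤ d
        · simp only [h2, if_true, Y, h1]
          split_ifs with h3
          · simp
          · rw [coeff_neg, coeff_eq_zero_of_natDegree_lt, neg_zero]
            have := hyd j
            omega
        · simp only [h2, if_false, S, h1, if_true]
          rw [coeff_C, if_neg (by omega)]
      · have h2 : ¬ l ≤ d := by omega
        simp only [h2, h1, if_false, S]
        exact coeff_sub_mul_of_lt x (natDegree_X_pow _) (by omega)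
  have hT : natDet (m + n) (fun i j => (S j).eval (z i) + W i * (Y j).eval (z i)) =
      (-1) ^ (k * d + (d + k)) * sylDet m n (k + 1) a b x t := by
    have e1 : m + n = 1 + (k + d) := by omega
    rw [pow_add, ← hU, mul_right_comm, sylDet, e1]
    change _ = (-1) ^ (k * d) * natDet (1 + (k + d)) (fun i j =>
      if j < k + 1 then z i ^ j else W i * z i ^ (j - (k + 1))) * _
    rw [← hswap, add_comm d k, ← natDet_mul]
    apply natDet_congr
    intro i _ j hj
    have hj' : j < 1 + (d + k) := by omega
    rw [show 1 + (k + d) = 1 + d + k by ring, sum_range_add, sum_range_add, sum_range_one,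
      eval_eq_sum_range' (hY j hj'), eval_eq_sum_range' (hS j hj'), sum_range_succ', mul_sum]
    have hA : ∑ l ∈ range d, W i * ((Y j).coeff l * z i ^ l) = ∑ l ∈ range d,
        (if (if 1 + l < 1 then 1 + l else if 1 + l < 1 + d then 1 + l + k else 1 + l - d) < k + 1
          then z i ^ (if 1 + l < 1 then 1 + l else if 1 + l < 1 + d then 1 + l + k else 1 + l - d)
          else W i * z i ^ ((if 1 + l < 1 then 1 + l else if 1 + l < 1 + d then 1 + l + k
            else 1 + l - d) - (k + 1))) *
        (if 1 + l = 0 then (S j).coeff 0 else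
          if 1 + l ≤ d then (Y j).coeff (1 + l - 1) else (S j).coeff (1 + l - d)) := by
      refine sum_congr rfl fun l hl => ?_
      rw [mem_range] at hl
      have e2 : (if 1 + l < 1 then 1 + l else if 1 + l < 1 + d then 1 + l + k else 1 + l - d) =
          k + 1 + l := by split_ifs <;> omega
      rw [e2, if_neg (by omega), if_neg (by omega), if_pos (by omega), add_tsub_cancel_left,
        add_tsub_cancel_left]
      ring
    have hB : ∑ l ∈ range k, (S j).coeff (l + 1) * z i ^ (l + 1) = ∑ l ∈ range k,
        (if (if 1 + d + l < 1 then 1 + d + l else if 1 + d + l < 1 + d then 1 + d + l + k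
            else 1 + d + l - d) < k + 1
          then z i ^ (if 1 + d + l < 1 then 1 + d + l else if 1 + d + l < 1 + d then 1 + d + l + k
            else 1 + d + l - d)
          else W i * z i ^ ((if 1 + d + l < 1 then 1 + d + l else if 1 + d + l < 1 + d
            then 1 + d + l + k else 1 + d + l - d) - (k + 1))) *
        (if 1 + d + l = 0 then (S j).coeff 0 else
          if 1 + d + l ≤ d then (Y j).coeff (1 + d + l - 1) else (S j).coeff (1 + d + l - d)) := by
      refine sum_congr rfl fun l hl => ?_
      rw [mem_range] at hl
      have e2 : (if 1 + d + l < 1 then 1 + d + l else if 1 + d + l < 1 + d then 1 + d + l + k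
            else 1 + d + l - d) = l + 1 := by split_ifs <;> omega
      rw [e2, if_pos (by omega), if_neg (by omega), if_neg (by omega),
        show 1 + d + l - d = l + 1 by omega]
      ring
    rw [hA, hB]
    simp only [if_true, zero_lt_iff, pow_zero, Nat.succ_ne_zero, ne_eq,
      not_false_eq_true]
    ring
  have hsq : ∀ u : R, u = (-1) ^ (k * d + (d + k)) * ((-1) ^ (k * d + (d + k)) * u) := by
    intro u
    rw [← mul_assoc, ← pow_add, Even.neg_one_pow ⟨_, rfl⟩, one_mul]
  rw [hsq (sylDet m n (k + 1) a b x t), ← hT, mul_assoc]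
  congr 1
  rw [natDet_split_left a (fun j => X ^ j) (fun j _ => monic_X_pow j)
    (fun j _ => natDegree_X_pow j)]
  · congr 1
    have hpr := prod_range_ite_lt (n - k) k 1 (1 - t)
    rw [one_pow, one_mul, Nat.sub_add_cancel hkn.le] at hpr
    rw [← hpr, evalDet, ← natDet_smul_col]
    apply natDet_congr
    intro i _ j hj
    have hi : ¬ m + i < m := by omega
    have hzb : z (m + i) = b i := by simp [hz, concat]
    have hWb : W (m + i) = t * (x - b i) := by simp [hW, sylWeight, concat]
    rw [hzb, hWb]
    by_cases hj' : j < n - k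
    · have h1 : m + j ≤ d := by omega
      have h2 : m + j ≠ 0 := by omega
      have hpj : p (m + j) = f * X ^ j := by simp [hp, divBasis]
      have hyj := congrArg (eval (b i)) (hy (m + j))
      simp only [S, Y, h1, h2, hj', if_true, if_false, hornerFam, one_mul]
      rw [hpj] at hyj ⊢
      simp only [eval_add, eval_sub, eval_neg, eval_mul, eval_C, eval_X] at hyj ⊢
      linear_combination (-t) * hyj
    · have h1 : ¬ m + j ≤ d := by omega
      have h2 : m + j - (d + 1) = j - (n - k) := by omega
      simp only [S, Y, h1, h2, hj', if_false, hornerFam, eval_sub, eval_neg, eval_mul, eval_C,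
        eval_X, eval_pow]
      ring
  · intro i hi j hj
    have hza : z i = a i := by simp [hz, concat, hi]
    have hWa : W i = x - a i := by simp [hW, sylWeight, concat, hi]
    have h1 : j ≤ d := by omega
    have hpj : p j = X ^ j := by simp [hp, divBasis, hj]
    have hyj := congrArg (eval (a i)) (hy j)
    rw [hpj] at hyj
    rw [hza, hWa]
    simp only [S, Y, h1, if_true, hpj]
    by_cases h2 : j = 0
    · simp [h2]
    · simp only [h2, if_false, eval_sub, eval_neg, eval_mul, eval_C, eval_X] at hyj ⊢
      linear_combination -hyj
  · intro i hi j hj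
    have hza : z i = a i := by simp [hz, concat, hi]
    have hWa : W i = x - a i := by simp [hW, sylWeight, concat, hi]
    rw [hza, hWa]
    by_cases h1 : m + j ≤ d
    · have h2 : m + j ≠ 0 := by omega
      have hpj : p (m + j) = f * X ^ j := by simp [hp, divBasis]
      have hyj := congrArg (eval (a i)) (hy (m + j))
      have h0 : (p (m + j)).eval (a i) = 0 := by
        rw [hpj, eval_mul, hf, nodal_eval_self a hi, zero_mul]
      rw [h0] at hyj
      simp only [S, Y, h1, h2, if_true, if_false, eval_sub, eval_neg, eval_mul, eval_C,
        eval_X] at hyj ⊢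
      linear_combination -hyj
    · simp only [S, Y, h1, if_false, eval_sub, eval_neg, eval_mul, eval_C, eval_X, eval_pow]
      ring

end Reduction

/-! ### Comparison of coefficients -/

section Assembly

/-- Exponents of `-1` matter modulo `2` only, where identities between them are decidable. -/
lemma neg_one_pow_eq_of_zmod {R : Type*} [Ring R] {i j : ℕ} (h : (i : ZMod 2) = j) :
    (-1 : R) ^ i = (-1) ^ j := by
  apply neg_one_pow_congr
  rw [← ZMod.natCast_eq_zero_iff_even, ← ZMod.natCast_eq_zero_iff_even, h]

lemma nodal_map {R S : Type*} [CommRing R] [CommRing S] (φ : R →+* S) (m : ℕ) (a : ℕ → R) :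
    (nodal m a).map φ = nodal m fun i => φ (a i) := by
  simp [nodal, Polynomial.map_prod]

variable {K : Type*} [Field K]

lemma sres_eq {m n k : ℕ} (hm : k ≤ m) (hn : k < n) (f g : K[X]) :
    sres m n k f g = bezoutF m n k f g * f + bezoutG m n k f g * g := by
  simp only [sres, bezoutF, bezoutG, det_subresMatrix hm hn.le]
  rw [subDet_add hn]
  simp only [mul_comm _ f, mul_comm _ g]
  rw [subDet_mul_left (by omega), subDet_mul_right (by omega)]

/-- The determinant of values at the roots of `g`, over `K[x][t]`. -/
lemma evalDet_hornerFam_eq_bezout {m n k : ℕ} (hkm : k ≤ m) (hkn : k < n) (a b : ℕ → K)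
    {α : K[X][X]} (hα : α ≠ 0) :
    evalDet n (fun i => (C (C (b i)) : K[X][X])) (hornerFam (n - k)
      (fun j => C α * (nodal m (fun i => C (C (a i))) * X ^ j) +
        C ((1 - α) * (nodal m (fun i => C (C (a i))) * X ^ j).eval (C X)))
      (fun j => X ^ j) (C X)) =
    (-1) ^ (m * (n - k)) * C (C (vdm n b)) *
      (α ^ (n - k - 1) * C (bezoutF m n k (nodal m a) (nodal n b) * nodal m a) +
       α ^ (n - k) * C (bezoutG m n k (nodal m a) (nodal n b) * nodal n b)) := by
  have hmap : ∀ (N : ℕ) (c : ℕ → K), nodal N (fun i => (C (C (c i)) : K[X][X])) =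
      ((nodal N c).map C).map C := by
    intro N c
    rw [nodal_map, nodal_map]
  have heval : ∀ (N : ℕ) (c : ℕ → K), (nodal N (fun i => (C (C (c i)) : K[X][X]))).eval (C X) =
      C (nodal N c) := by
    intro N c
    rw [hmap, eval_map, eval₂_at_apply, eval_map, eval₂_C_X]
  rw [evalDet_hornerFam hkm hkn _ _ (nodal_natDegree _ _).le _ _ hα, heval, heval, bezoutF, bezoutG,
    det_subresMatrix hkm hkn.le, det_subresMatrix hkm hkn.le, C_mul, C_mul, subDet_map, subDet_map,
    ← hmap, ← hmap, vdm_map, vdm_map]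
  simp only [map_pow, map_zero]
  ring

section Coefficient

variable [DecidableEq K] {m n p q d : ℕ} {a b : ℕ → K} {a' : Fin m ↪ K} {b' : Fin n ↪ K}

lemma syl_eq_of_coeff {e : ℕ} (h : m + n = e + d) (hd : d = p + q)
    (ha : ∀ i, a' i = a i) (hb : ∀ i, b' i = b i) {Z : K[X]}
    (hZ : (sylDet m n e (fun i => (C (C (a i)) : K[X][X])) (fun i => C (C (b i))) (C X) X).coeff q =
      C (vdm m a * vdm n b) * Z) :
    syl p q (univ.map a') (univ.map b') = (-1) ^ (m * (n - q) + p * q) * Z := by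
  have hV : ∀ {N : ℕ} {c : ℕ → K} (c' : Fin N ↪ K), (∀ i, c' i = c i) → vdm N c ≠ 0 := by
    intro N c c' hc
    apply vdm_ne_zero
    intro i hi j hj hij
    have := c'.injective ((hc ⟨i, hi⟩).trans (hij.trans (hc ⟨j, hj⟩).symm))
    exact congrArg Fin.val this
  rw [coeff_sylDet h hd a b a' b' ha hb] at hZ
  have h1 := mul_left_cancel₀ (C_ne_zero.2 (mul_ne_zero (hV a' ha) (hV b' hb))) hZ
  rw [← h1, ← mul_assoc, ← pow_add, Even.neg_one_pow ⟨_, rfl⟩, one_mul]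

/-- For `j > N` the subtraction `N - j` is truncated, but then the binomial coefficient is `0`. -/
lemma coeff_X_sub_one_pow {R : Type*} [CommRing R] (N j : ℕ) :
    ((X - 1 : R[X]) ^ N).coeff j = (-1) ^ (N - j) * (N.choose j : R) := by
  rw [sub_eq_add_neg, ← C_1, ← C_neg, coeff_X_add_C_pow]

lemma syl_eq_sres (hd : d = p + q) (hdm : d ≤ m) (hdn : d < n) (hmn : m ≤ n)
    (ha : ∀ i, a' i = a i) (hb : ∀ i, b' i = b i) :
    syl p q (univ.map a') (univ.map b') =
      (-1) ^ (p * (m - d)) * (d.choose p : K[X]) * sres m n d (nodal m a) (nodal n b) := by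
  have h : m + n = (m + n - d) + d := by omega
  have hE := evalDet_hornerFam_eq_bezout hdm hdn a b (one_ne_zero (α := K[X][X]))
  simp only [map_one, one_mul, sub_self, zero_mul, map_zero, add_zero, one_pow] at hE
  rw [syl_eq_of_coeff h hd ha hb (Z := (-1) ^ p * (d.choose q : K[X]) * ((-1) ^ (m * (n - d)) *
    sres m n d (nodal m a) (nodal n b)))]
  · have hs : ((-1 : K[X])) ^ (p * (m - d)) =
        (-1) ^ (m * (n - q) + p * q) * (-1) ^ p * (-1) ^ (m * (n - d)) := by
      obtain ⟨u, rfl⟩ := Nat.exists_eq_add_of_le hdm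
      obtain ⟨v, rfl⟩ := Nat.exists_eq_add_of_le hdn.le
      subst hd
      rw [← pow_add, ← pow_add, show p + q + v - q = p + v by omega, add_tsub_cancel_left,
        add_tsub_cancel_left]
      apply neg_one_pow_congr
      simp only [Nat.even_add, Nat.even_mul]
      tauto
    have hc : d.choose p = d.choose q := by rw [hd, Nat.choose_symm_add]
    rw [hs, hc]
    ring
  · rw [sylDet_eq_of_le h (by omega) hdn.le, hE, vdm_map, vdm_map, ← C_add,
      ← sres_eq hdm hdn]
    have h1 : C (C (vdm m a)) * ((X - 1 : K[X][X]) ^ d * ((-1) ^ (m * (n - d)) * C (C (vdm n b)) *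
        C (sres m n d (nodal m a) (nodal n b)))) =
        C (C (vdm m a * vdm n b) * ((-1) ^ (m * (n - d)) * sres m n d (nodal m a) (nodal n b))) *
          (X - 1) ^ d := by
      simp only [map_mul, map_pow, map_neg, map_one]
      ring
    simp only [vdm_map] at h1 ⊢
    rw [h1, coeff_C_mul, coeff_X_sub_one_pow, show d - q = p by omega]
    ring

lemma syl_eq_zero (hd : d = p + q) (hmd : m < d) (hdn : d + 1 < n)
    (ha : ∀ i, a' i = a i) (hb : ∀ i, b' i = b i) :
    syl p q (univ.map a') (univ.map b') = 0 := by
  have h : m + n = (m + n - d) + d := by omega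
  rw [syl_eq_of_coeff h hd ha hb (Z := 0), mul_zero]
  rw [sylDet_eq_zero h hmd hdn, coeff_zero, mul_zero]

lemma syl_eq_of_succ_eq (hd : d = p + q) (hp : p ≤ m) (hmd : m < d) (hdn : d + 1 = n)
    (ha : ∀ i, a' i = a i) (hb : ∀ i, b' i = b i) :
    syl p q (univ.map a') (univ.map b') =
      (-1) ^ ((p + 1) * (m + n - 1)) * (m.choose p : K[X]) * nodal m a := by
  have h : m + n = (m + n - d) + d := by omega
  have heval : (nodal m (fun i => (C (C (a i)) : K[X][X]))).eval (C X) = C (nodal m a) := by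
    rw [← nodal_map C m fun i => C (a i), ← nodal_map, eval_map, eval₂_at_apply, eval_map,
      eval₂_C_X]
  rw [syl_eq_of_coeff h hd ha hb (Z := (-1) ^ p * (m.choose p : K[X]) * ((-1) ^ d * nodal m a))]
  · have hs : ((-1 : K[X])) ^ ((p + 1) * (m + n - 1)) =
        (-1) ^ (m * (n - q) + p * q) * (-1) ^ p * (-1) ^ d := by
      subst hdn hd
      rw [← pow_add, ← pow_add, show p + q + 1 - q = p + 1 by omega,
        show m + (p + q + 1) - 1 = m + p + q by omega]
      apply neg_one_pow_congr
      simp only [Nat.even_add, Nat.even_mul, Nat.not_even_one]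
      tauto
    rw [hs]
    ring
  · rw [sylDet_eq_of_succ_eq h hmd hdn, heval]
    have h1 : C (C (vdm m a)) * C (C (vdm n b)) *
        ((X - 1 : K[X][X]) ^ m * X ^ (d - m) * ((-1) ^ d * C (nodal m a))) =
        C (C (vdm m a * vdm n b) * ((-1) ^ d * nodal m a)) * ((X - 1) ^ m * X ^ (d - m)) := by
      simp only [map_mul, map_pow, map_neg, map_one]
      ring
    simp only [vdm_map] at h1 ⊢
    rw [h1, coeff_C_mul, coeff_mul_X_pow', if_pos (by omega), coeff_X_sub_one_pow,
      show m - (q - (d - m)) = p by omega, ← Nat.choose_symm hp,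
      show q - (d - m) = m - p by omega]
    ring

/-- The exponent `(d + m) * (n + q) + d + n + 1` is congruent to `σ` modulo `2`. -/
lemma syl_eq_bezout {k : ℕ} (hd : d = p + q) (hp : p ≤ m) (hq : q ≤ n) (hmn : m ≤ n) (hnd : n ≤ d)
    (hk : k + d + 1 = m + n) (ha : ∀ i, a' i = a i) (hb : ∀ i, b' i = b i) :
    syl p q (univ.map a') (univ.map b') =
      (-1) ^ ((d + m) * (n + q) + d + n + 1) *
        ((k.choose (m - p) : K[X]) * bezoutF m n k (nodal m a) (nodal n b) * nodal m a -
          (k.choose (n - q) : K[X]) * bezoutG m n k (nodal m a) (nodal n b) * nodal n b) := by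
  have h : m + n = (k + 1) + d := by omega
  have hkm : k < m := by omega
  have hkn : k < n := by omega
  have hE := evalDet_hornerFam_eq_bezout hkm.le hkn a b (X_ne_zero (R := K[X]))
  set F := bezoutF m n k (nodal m a) (nodal n b) with hF
  set G := bezoutG m n k (nodal m a) (nodal n b) with hG
  rw [syl_eq_of_coeff h hd ha hb (Z := (-1) ^ (k * d + (d + k) + k + m * (n - k) + (k + m + p)) *
    ((k.choose (m - p) : K[X]) * (F * nodal m a) - (k.choose (n - q) : K[X]) * (G * nodal n b)))]
  · rw [← mul_assoc, ← pow_add]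
    congr 1
    · obtain ⟨u, rfl⟩ := Nat.exists_eq_add_of_le hp
      obtain ⟨v, rfl⟩ := Nat.exists_eq_add_of_le hq
      obtain ⟨w, hw⟩ := Nat.exists_eq_add_of_le hkn.le
      rw [show q + v - q = v by omega, show q + v - k = w by omega]
      have hk' : k + 1 = u + v := by omega
      have e1 := congrArg (Nat.cast : ℕ → ZMod 2) hk'
      have e2 := congrArg (Nat.cast : ℕ → ZMod 2) hw
      subst hd
      apply neg_one_pow_eq_of_zmod
      push_cast at e1 e2 ⊢
      clear * - e1 e2
      generalize (p : ZMod 2) = p, (q : ZMod 2) = q, (u : ZMod 2) = u, (v : ZMod 2) = v,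
        (w : ZMod 2) = w, (k : ZMod 2) = k at *
      revert p q u v w k
      decide
    · ring
  · rw [sylDet_eq_of_ge h (by omega) hkm hkn, hE]
    have h1 : (-1) ^ (k * d + (d + k)) * C (C (vdm m a)) * ((1 - X : K[X][X]) ^ k *
        ((-1) ^ (m * (n - k)) * C (C (vdm n b)) *
        (X ^ (n - k - 1) * C (F * nodal m a) + X ^ (n - k) * C (G * nodal n b)))) =
        C (C (vdm m a * vdm n b) * (-1) ^ (k * d + (d + k) + k + m * (n - k))) *
          (C (F * nodal m a) * ((X - 1) ^ k * X ^ (n - k - 1)) +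
            C (G * nodal n b) * ((X - 1) ^ k * X ^ (n - k))) := by
      rw [show (1 - X : K[X][X]) = (-1) * (X - 1) by ring, mul_pow]
      simp only [map_mul, map_pow, map_neg, map_one]
      ring
    simp only [vdm_map] at h1 ⊢
    rw [h1, coeff_C_mul, coeff_add, coeff_C_mul, coeff_C_mul, coeff_mul_X_pow', coeff_mul_X_pow',
      if_pos (by omega), coeff_X_sub_one_pow, coeff_X_sub_one_pow,
      show q - (n - k - 1) = m - p by omega]
    -- For `m - p = k + 1` the exponent is truncated, but the binomial coefficient vanishes.
    have s1 : ((-1 : K[X])) ^ (k - (m - p)) * (k.choose (m - p) : K[X]) =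
        (-1) ^ (k + m + p) * (k.choose (m - p) : K[X]) := by
      by_cases hkp : m - p ≤ k
      · congr 1
        rw [show k + m + p = k - (m - p) + 2 * m by omega, pow_add, pow_mul]
        simp
      · rw [Nat.choose_eq_zero_of_lt (by omega)]
        simp
    rw [s1, pow_add (-1) _ (k + m + p)]
    by_cases hr : n - k ≤ q
    · have hc : k.choose (q - (n - k)) = k.choose (n - q) := by
        rw [← Nat.choose_symm (by omega)]
        congr 1
        omega
      have s2 : ((-1 : K[X])) ^ (k - (q - (n - k))) = - (-1) ^ (k + m + p) := by
        rw [neg_eq_neg_one_mul ((-1 : K[X]) ^ (k + m + p)), ← pow_succ',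
          show k + m + p + 1 = k - (q - (n - k)) + 2 * m by omega, pow_add, pow_mul]
        simp
      rw [if_pos hr, hc, s2]
      ring
    · have hc : k.choose (n - q) = 0 := Nat.choose_eq_zero_of_lt (by omega)
      rw [if_neg hr, hc]
      rw [Nat.cast_zero, C_mul]
      ring

end Coefficient

end Assembly

/-! ### The enumerated sets and the extreme cases -/

lemma exists_enumeration {K : Type*} [Zero K] {m : ℕ} (A : Finset K) (hA : A.card = m) :
    ∃ (a : ℕ → K) (a' : Fin m ↪ K), (∀ i, a' i = a i) ∧ univ.map a' = A := by
  let e := (A.equivFinOfCardEq hA).symm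
  let a' : Fin m ↪ K := e.toEmbedding.trans (Function.Embedding.subtype _)
  refine ⟨fun i => if h : i < m then a' ⟨i, h⟩ else 0, a', fun i => by simp, ?_⟩
  ext x
  simp only [mem_map, mem_univ, true_and]
  constructor
  · rintro ⟨i, rfl⟩
    exact (e i).2
  · intro hx
    exact ⟨e.symm ⟨x, hx⟩, by simp [a']⟩

lemma prod_eq_nodal {K : Type*} [Field K] {m : ℕ} {a : ℕ → K} {a' : Fin m ↪ K}
    (ha : ∀ i, a' i = a i) : ∏ α ∈ univ.map a', (X - C α) = nodal m a := by
  rw [prod_map, nodal, ← Fin.prod_univ_eq_prod_range (fun i => X - C (a i))]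
  simp only [ha]

lemma resultant_prod {K : Type*} [Field K] (A B : Finset K) :
    resultant (∏ α ∈ A, (X - C α)) (∏ β ∈ B, (X - C β)) = prodDiff A B := by
  have := resultant_prod_X_sub_C A B id id
  simp only [id] at this
  rw [natDegree_finsetProd_X_sub_C_eq_card A fun x => x,
    natDegree_finsetProd_X_sub_C_eq_card B fun x => x, this, prodDiff]

lemma syl_zero_zero {K : Type*} [Field K] [DecidableEq K] (A B : Finset K) :
    syl 0 0 A B = C (prodDiff A B) := by
  simp [syl, prodDiff, rootPoly]

lemma syl_card_card {K : Type*} [Field K] [DecidableEq K] (A B : Finset K) :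
    syl A.card B.card A B = C (prodDiff A B) * (rootPoly A * rootPoly B) := by
  simp [syl, prodDiff]

lemma choose_add_choose_eq {k u v : ℕ} (h : u + v = k + 1) :
    k.choose v + k.choose u = (k + 1).choose u := by
  rcases u with _ | u
  · rw [Nat.choose_eq_zero_of_lt (by omega)]
    simp
  · rw [Nat.choose_succ_succ, ← Nat.choose_symm (show u ≤ k by omega),
      show k - u = v by omega]

lemma neg_one_zpow_eq {K : Type*} [Field K] {σ : ℤ} {e : ℕ} (h : Even (σ - e)) :
    (-1 : K) ^ σ = (-1) ^ e := by
  obtain ⟨r, hr⟩ := h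
  rw [show σ = e + 2 * r by omega, zpow_add₀ (by simp), zpow_mul, zpow_natCast]
  simp

end SylvesterSums

theorem theorem1p1 {K : Type*} [Field K] [DecidableEq K]
    (m n p q d : ℕ) (hm : 1 ≤ m) (hmn : m ≤ n) (hp : p ≤ m) (hq : q ≤ n) (hd : d = p + q)
    (A B : Finset K) (hA : A.card = m) (hB : B.card = n)
    (f g : K[X]) (hf : f = ∏ α ∈ A, (X - C α)) (hg : g = ∏ β ∈ B, (X - C β)) :
    ((d < m ∨ (m = d ∧ d < n)) →
      SylvesterSums.syl p q A B =
        (-1) ^ (p * (m - d)) * (d.choose p : K[X]) * SylvesterSums.sres m n d f g) ∧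
    ((m < d ∧ d + 1 < n) → SylvesterSums.syl p q A B = 0) ∧
    ((m < d ∧ d + 1 = n) →
      SylvesterSums.syl p q A B = (-1) ^ ((p + 1) * (m + n - 1)) * (m.choose p : K[X]) * f) ∧
    ((n ≤ d ∧ d + 1 ≤ m + n) →
      ∀ (k : ℕ) (σ : ℤ), k + d + 1 = m + n →
        σ = ((d : ℤ) - m) * ((n : ℤ) - q) + d - n - 1 →
        SylvesterSums.syl p q A B =
            C ((-1 : K) ^ σ) *
              ((k.choose (m - p) : K[X]) * SylvesterSums.bezoutF m n k f g * f -
                (k.choose (n - q) : K[X]) * SylvesterSums.bezoutG m n k f g * g) ∧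
        SylvesterSums.syl p q A B =
            C ((-1 : K) ^ (σ + 1)) *
              ((k.choose (n - q) : K[X]) * SylvesterSums.sres m n k f g -
                ((k + 1).choose (m - p) : K[X]) * SylvesterSums.bezoutF m n k f g * f) ∧
        SylvesterSums.sres m n k f g =
          SylvesterSums.bezoutF m n k f g * f + SylvesterSums.bezoutG m n k f g * g) ∧
    (d = m + n →
      SylvesterSums.sres m n 0 f g = C (resultant f g) ∧
      SylvesterSums.syl p q A B = C (resultant f g) * f * g) := by
  have hres : resultant f g = SylvesterSums.prodDiff A B := by
    rw [hf, hg, SylvesterSums.resultant_prod]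
  have hrf : SylvesterSums.rootPoly A = f := hf.symm
  have hrg : SylvesterSums.rootPoly B = g := hg.symm
  have hfull := SylvesterSums.syl_card_card A B
  have hzero := SylvesterSums.syl_zero_zero A B
  obtain ⟨a, a', ha, hA'⟩ := SylvesterSums.exists_enumeration A hA
  obtain ⟨b, b', hb, hB'⟩ := SylvesterSums.exists_enumeration B hB
  rw [← hA', SylvesterSums.prod_eq_nodal ha] at hf
  rw [← hB', SylvesterSums.prod_eq_nodal hb] at hg
  refine ⟨fun h => ?_, fun h => ?_, fun h => ?_, fun h k σ hk hσ => ?_, fun h => ⟨?_, ?_⟩⟩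
  · rw [← hA', ← hB', hf, hg, SylvesterSums.syl_eq_sres hd (by omega) (by omega) hmn ha hb]
  · rw [← hA', ← hB', SylvesterSums.syl_eq_zero hd h.1 h.2 ha hb]
  · rw [← hA', ← hB', hf, SylvesterSums.syl_eq_of_succ_eq hd hp h.1 h.2 ha hb]
  · have hS : SylvesterSums.sres m n k f g =
          SylvesterSums.bezoutF m n k f g * f + SylvesterSums.bezoutG m n k f g * g :=
      SylvesterSums.sres_eq (by omega) (by omega) f g
    have h1 : SylvesterSums.syl p q A B =
            C ((-1 : K) ^ σ) *
              ((k.choose (m - p) : K[X]) * SylvesterSums.bezoutF m n k f g * f -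
                (k.choose (n - q) : K[X]) * SylvesterSums.bezoutG m n k f g * g) := by
      have hs : (-1 : K) ^ σ = (-1) ^ ((d + m) * (n + q) + d + n + 1) := by
        apply SylvesterSums.neg_one_zpow_eq
        rw [hσ]
        push_cast
        exact ⟨-(d * q + m * n + n + 1), by ring⟩
      rw [hs, ← hA', ← hB', SylvesterSums.syl_eq_bezout hd hp hq hmn h.1 hk ha hb, ← hf, ← hg]
      simp
    refine ⟨h1, ?_, hS⟩
    rw [h1, hS, zpow_add_one₀ (by simp),
      ← SylvesterSums.choose_add_choose_eq (show m - p + (n - q) = k + 1 by omega)]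
    simp only [map_mul, map_neg, map_one]
    push_cast
    ring
  · rw [hres, ← hzero, ← hA', ← hB', hf, hg,
      SylvesterSums.syl_eq_sres (d := 0) rfl (by omega) (by omega) hmn ha hb]
    simp
  · have hpm : p = A.card := by omega
    have hqn : q = B.card := by omega
    rw [hpm, hqn, hfull, hres, hrf, hrg, mul_assoc]
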